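/- Let $\mathbb{Z}$ and $\mathbb{Y}$ be finite-dimensional real inner product spaces. Let $\mathcal{A}:\mathbb{Z}\rightrightarrows\mathbb{Z}$ be maximal monotone, let $\mathcal{B}:\mathbb{Z}\to\mathbb{Z}$ be single-valued and Lipschitz continuous, put $\mathcal{F}:=\mathcal{A}+\mathcal{B}$, and let $z^*\in\mathbb{Z}$ satisfy $0\in\mathcal{F}(z^*)$. Then $\mathcal{F}$ is metrically subregular at $(z^*,0)$, that is, there are $\kappa>0$ and a neighbourhood $U$ of $z^*$ with $$\mathrm{dist}\big(z,\mathcal{F}^{-1}(0)\big)\le\kappa\,\mathrm{dist}\big(0,\mathcal{F}(z)\big)\quad\text{for all } z\in U$$ (with $\mathrm{dist}(0,\emptyset)=+\infty$), whenever one of the following holds. (C1) $\mathcal{F}$ is strongly monotone: there is $\alpha>0$ such that $\langle x-y,u-v\rangle\ge\alpha\|x-y\|^2$ for all $u\in\mathcal{F}(x)$, $v\in\mathcal{F}(y)$. (C2) $\mathcal{B}$ is affine and $\mathcal{A}$ is a polyhedral operator, i.e. the graph of $\mathcal{A}$ is a union of finitely many polyhedral convex sets. (C3) $\mathcal{B}=\mathcal{E}^*\nabla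 f(\mathcal{E}\,\cdot)+C$, where $\mathcal{E}:\mathbb{Z}\to\mathbb{Y}$ is linear with adjoint $\mathcal{E}^*$, $C\in\mathbb{Z}$ is constant, and $f:\mathbb{Y}\to\mathbb{R}$ is differentiable and strongly convex with Lipschitz continuous gradient; and $\mathcal{A}$ is the subdifferential either of the $\ell_p$ norm for some $p\in[1,2]\cup\{\infty\}$ (with $\mathbb{Z}=\mathbb{R}^n$ carrying the Euclidean inner product, up to a linear isometry), or of a proper polyhedral convex function $\varphi:\mathbb{Z}\to(-\infty,+\infty]$, i.e. one whose epigraph is a polyhedral convex set. (C4) $\mathcal{B}=\mathcal{E}^*\nabla f(\mathcal{E}\,\cdot)+C$ with $f,\mathcal{E},C$ as in (C3); $\mathbb{Z}=\mathbb{R}^{m\times n}$ with the trace inner product (up to a linear isometry); $\mathcal{A}=\partial\|\cdot\|_*$ is the subdifferential of the nuclear norm (the sum of the singular values); and there is $x\in\mathbb{Z}$ with $-\mathcal{B}x\in\mathrm{ri}\,(\partial\|x\|_*)$. -/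

import Mathlib

open scoped ENNReal NNReal

/-! ### Set-valued operators `T : X ⇉ Y`, represented as maps `X → Set Y` -/

/-- The graph `{(x, y) | y ∈ T x}` of a set-valued operator. -/
def opGraph {X Y : Type*} (T : X → Set Y) : Set (X × Y) :=
  {q | q.2 ∈ T q.1}

/-- The inverse operator, `x ∈ T⁻¹ y ↔ y ∈ T x`. -/
def opInv {X Y : Type*} (T : X → Set Y) : Y → Set X :=
  fun y => {x | y ∈ T x}

/-- The sum `A + B` of a set-valued operator `A` and a single-valued operator `B`. -/
def opAdd {X Y : Type*} [Add Y] (A : X → Set Y) (B : X → Y) : X → Set Y :=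
  fun x => {y | ∃ a ∈ A x, y = a + B x}

/-- `T` is metrically subregular at `(x₀, y₀) ∈ gph T`: for some `κ > 0` and some neighbourhood `U`
of `x₀`, `dist (x, T⁻¹ y₀) ≤ κ * dist (y₀, T x)` for all `x ∈ U`. Distances to sets are
`[0, ∞]`-valued, the distance to the empty set being `∞`. -/
def MetricallySubregularAt {X Y : Type*} [PseudoEMetricSpace X] [PseudoEMetricSpace Y]
    (T : X → Set Y) (x₀ : X) (y₀ : Y) : Prop :=
  y₀ ∈ T x₀ ∧ ∃ κ : ℝ≥0, 0 < κ ∧ ∃ U ∈ nhds x₀, ∀ x ∈ U,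
    Metric.infEDist x (opInv T y₀) ≤ (κ : ℝ≥0∞) * Metric.infEDist y₀ (T x)

section Operators

variable {Z : Type*} [NormedAddCommGroup Z] [InnerProductSpace ℝ Z]

/-- `T` is monotone. -/
def IsMonotoneOp (T : Z → Set Z) : Prop :=
  ∀ x y u v : Z, u ∈ T x → v ∈ T y → 0 ≤ inner ℝ (x - y) (u - v)

/-- `T` is maximal monotone: its graph is maximal, for inclusion, among graphs of monotone
operators. -/
def IsMaximalMonotoneOp (T : Z → Set Z) : Prop :=
  IsMonotoneOp T ∧
    ∀ S : Z → Set Z, IsMonotoneOp S → opGraph T ⊆ opGraph S → opGraph S ⊆ opGraph T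

/-- `T` is strongly monotone (with some constant `α > 0`). -/
def IsStronglyMonotoneOp (T : Z → Set Z) : Prop :=
  ∃ α : ℝ, 0 < α ∧
    ∀ x y u v : Z, u ∈ T x → v ∈ T y → α * ‖x - y‖ ^ 2 ≤ inner ℝ (x - y) (u - v)

/-- The convex subdifferential of an extended-real-valued function. -/
def subdiffOp (φ : Z → EReal) : Z → Set Z :=
  fun x => {v | ∀ y : Z, φ x + ((inner ℝ v (y - x) : ℝ) : EReal) ≤ φ y}

end Operators

/-! ### Polyhedral objects -/

/-- A polyhedral convex set: the intersection of finitely many closed half-spaces (for use in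
finite-dimensional spaces). -/
def IsPolyhedralSet {E : Type*} [AddCommGroup E] [Module ℝ E] (s : Set E) : Prop :=
  ∃ (k : ℕ) (l : Fin k → (E →ₗ[ℝ] ℝ)) (b : Fin k → ℝ), s = {x | ∀ i, l i x ≤ b i}

/-- A polyhedral operator: its graph is a union of finitely many polyhedral convex sets. -/
def IsPolyhedralOp {X Y : Type*} [AddCommGroup X] [Module ℝ X] [AddCommGroup Y] [Module ℝ Y]
    (T : X → Set Y) : Prop :=
  ∃ (k : ℕ) (P : Fin k → Set (X × Y)), (∀ i, IsPolyhedralSet (P i)) ∧ opGraph T = ⋃ i, P i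

/-- A (proper) polyhedral convex function with values in `(-∞, +∞]`: its epigraph is a polyhedral
convex set. -/
def IsPolyhedralFun {E : Type*} [AddCommGroup E] [Module ℝ E] (φ : E → EReal) : Prop :=
  (∀ x, φ x ≠ ⊥) ∧ (∃ x, φ x ≠ ⊤) ∧ IsPolyhedralSet {q : E × ℝ | φ q.1 ≤ (q.2 : EReal)}

/-! ### Norms -/

/-- The nuclear norm of a real matrix: the sum of its singular values. -/
noncomputable def nuclearNorm {m n : ℕ} (X : Matrix (Fin m) (Fin n) ℝ) : ℝ :=
  (Matrix.toEuclideanLin X).singularValues.sum fun _ s => s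

/-! ### The four conditions -/

section Conditions

variable {Z : Type*} [NormedAddCommGroup Z] [InnerProductSpace ℝ Z] [FiniteDimensional ℝ Z]

/-- (C1): `A + B` is strongly monotone. -/
def CondC1 (A : Z → Set Z) (B : Z → Z) : Prop :=
  IsStronglyMonotoneOp (opAdd A B)

/-- (C2): `B` is affine and `A` is polyhedral. -/
def CondC2 (A : Z → Set Z) (B : Z → Z) : Prop :=
  (∃ g : Z →ᵃ[ℝ] Z, ∀ z, B z = g z) ∧ IsPolyhedralOp A

/-- `B = E* ∇f(E ·) + c` with `E : Z → Y` linear, `c ∈ Z` constant, and `f : Y → ℝ`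
differentiable, strongly convex and with Lipschitz continuous gradient. -/
def IsCompositeGradient (Y : Type*) [NormedAddCommGroup Y] [InnerProductSpace ℝ Y]
    [FiniteDimensional ℝ Y] (B : Z → Z) : Prop :=
  haveI : CompleteSpace Y := FiniteDimensional.complete ℝ Y
  ∃ (f : Y → ℝ) (E : Z →ₗ[ℝ] Y) (c : Z),
    (∃ μ : ℝ, 0 < μ ∧ StrongConvexOn Set.univ μ f) ∧
    Differentiable ℝ f ∧
    (∃ L : ℝ≥0, LipschitzWith L (gradient f)) ∧
    ∀ z, B z = LinearMap.adjoint E (gradient f (E z)) + c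

/-- `A` is the subdifferential of the `ℓ_p` norm for some `p ∈ [1, 2] ∪ {∞}`, where `Z` is
identified with `ℝⁿ` by a linear isometry `e`. -/
def IsLpNormSubdiff (A : Z → Set Z) : Prop :=
  ∃ (n : ℕ) (e : Z ≃ₗᵢ[ℝ] EuclideanSpace ℝ (Fin n)) (p : ℝ≥0∞),
    ((1 ≤ p ∧ p ≤ 2) ∨ p = ∞) ∧
    A = subdiffOp fun z => ((‖WithLp.toLp p (WithLp.ofLp (e z))‖ : ℝ) : EReal)

/-- `A` is the subdifferential of a polyhedral convex function. -/
def IsPolyhedralSubdiff (A : Z → Set Z) : Prop :=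
  ∃ φ : Z → EReal, IsPolyhedralFun φ ∧ A = subdiffOp φ

/-- (C3): `B = E* ∇f(E ·) + c` and `A` is the subdifferential of an `ℓ_p` norm with
`p ∈ [1, 2] ∪ {∞}` or of a polyhedral convex function. -/
def CondC3 (Y : Type*) [NormedAddCommGroup Y] [InnerProductSpace ℝ Y] [FiniteDimensional ℝ Y]
    (A : Z → Set Z) (B : Z → Z) : Prop :=
  IsCompositeGradient Y B ∧ (IsLpNormSubdiff A ∨ IsPolyhedralSubdiff A)

/-- (C4): `B = E* ∇f(E ·) + c`, and `A` is the subdifferential of the nuclear norm, where `Z` is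
identified by a linear equivalence `e` with the space of real `m × n` matrices under the trace
inner product; moreover `-B x` lies in the relative interior of the subdifferential of the nuclear
norm at `x`, for some `x` (which is then a zero of `A + B`). -/
def CondC4 (Y : Type*) [NormedAddCommGroup Y] [InnerProductSpace ℝ Y] [FiniteDimensional ℝ Y]
    (A : Z → Set Z) (B : Z → Z) : Prop :=
  IsCompositeGradient Y B ∧
    ∃ (m n : ℕ) (e : Z ≃ₗ[ℝ] Matrix (Fin m) (Fin n) ℝ),
      (∀ x y : Z, inner ℝ x y = Matrix.trace (Matrix.transpose (e x) * e y)) ∧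
      (A = subdiffOp fun z => ((nuclearNorm (e z) : ℝ) : EReal)) ∧
      ∃ x : Z, -B x ∈ intrinsicInterior ℝ
        (subdiffOp (fun z => ((nuclearNorm (e z) : ℝ) : EReal)) x)

end Conditions

/-!
Metric subregularity of `A + B` at a zero `z₀` asks for a zero `p` near `z` with
`‖z - p‖ ≤ κ ‖u‖` for every `u ∈ A z + B z`, `z` near `z₀`.

Under (C1) the zero is unique and the estimate is the Cauchy-Schwarz inequality. Under (C2) the graph
of `A + B` is a finite union of polyhedra, and Hoffman's bound (`exists_hoffman_constant`), applied
piece by piece, gives Robinson's theorem (`IsPolyhedralOp.metricallySubregularAt`).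

In (C3) and (C4), `A = ∂φ` and `B = E* ∇f(E ·) + c`. Put `g = -B z₀`, and let `G(z) ≥ 0` be the gap
between `φ` and its affine minorant of slope `g` at `z₀`. Any `p` with `E p = E z₀` and `g ∈ ∂φ(p)` is
a zero, and strong monotonicity of `∇f` gives `μ ‖E z - E z₀‖² + G(z) ≤ ‖u‖ ‖z - p‖`. It suffices
therefore that some such `p` satisfies the quadratic growth condition
`‖z - p‖² ≤ κ (‖E z - E z₀‖² + G(z))` (`QuadraticGrowthAt.metricallySubregularAt`), which is a
statement about `φ`, `E` and `g` only:

* for polyhedral `φ`, the `ℓ_1` and `ℓ_∞` norms among them, the points `p` form a polyhedron and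
  Hoffman's bound applies (`IsPolyhedralFun.quadraticGrowthAt`);
* for the `ℓ_p` norm with `1 < p ≤ 2`, the points with `g ∈ ∂φ(p)` form at most a ray, and growth away
  from it is the quadratic modulus of convexity of the norm
  (`quadraticGrowthAt_of_uniformly_convex`, `PiLp.norm_add_le_two_sub`);
* for the nuclear norm, the points with `g ∈ ∂φ(p)` are the `g H` with `H` positive semidefinite and
  carried by the subspace on which `g` is isometric. Growth away from this cone is read off a singular
  value decomposition of `z` (`exists_exposedCone_norm_sub_sq_le`), and the relative interior
  condition lets the affine constraint `E p = E z₀` be restored at proportional cost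
  (`quadraticGrowthAt_of_relative_interior`).
-/

/-! ### Hoffman's error bound and polyhedral operators -/

section Hoffman

variable {E : Type*} [NormedAddCommGroup E] [NormedSpace ℝ E] [FiniteDimensional ℝ E]

/-- **Hoffman's error bound.** The constant depends only on the functionals `l i`, not on the
right-hand side. -/
theorem exists_hoffman_constant {ι : Type*} [Finite ι] (l : ι → E →ₗ[ℝ] ℝ) :
    ∃ κ : ℝ, 0 < κ ∧ ∀ b : ι → ℝ, (∃ x₀, ∀ i, l i x₀ ≤ b i) → ∀ (x : E) (δ : ℝ), 0 ≤ δ →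
      (∀ i, l i x ≤ b i + δ) → ∃ p, (∀ i, l i p ≤ b i) ∧ ‖x - p‖ ≤ κ * δ := by
  classical
  have := Fintype.ofFinite ι
  have hl : ∀ i, Continuous (l i) := fun i => (l i).continuous_of_finiteDimensional
  -- For every set `I` of constraints that admits one, fix a common direction of descent `d I`.
  have hch : ∀ I : Finset ι, ∃ d : E, (∃ d' : E, ∀ i ∈ I, l i d' ≤ -1) → ∀ i ∈ I, l i d ≤ -1 := by
    intro I
    by_cases h : ∃ d' : E, ∀ i ∈ I, l i d' ≤ -1
    · obtain ⟨d, hd⟩ := h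
      exact ⟨d, fun _ => hd⟩
    · exact ⟨0, fun h' => absurd h' h⟩
  choose d hd using hch
  set κ : ℝ := 1 + ∑ I : Finset ι, ‖d I‖ with hκdef
  have hdκ : ∀ I, ‖d I‖ ≤ κ := by
    intro I
    have := Finset.single_le_sum (f := fun I : Finset ι => ‖d I‖) (fun _ _ => norm_nonneg _)
      (Finset.mem_univ I)
    linarith
  have hκ : 0 < κ := by
    have : 0 ≤ ∑ I : Finset ι, ‖d I‖ := Finset.sum_nonneg fun _ _ => norm_nonneg _
    linarith
  refine ⟨κ, hκ, ?_⟩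
  rintro b ⟨x₀, hx₀⟩ x δ hδ hx
  -- Among the points `y` reached from `x` at speed at most `κ`, minimise the remaining violation.
  let S : Set (E × ℝ) :=
    {q | 0 ≤ q.2 ∧ ‖x - q.1‖ ≤ κ * (δ - q.2) ∧ ∀ i, l i q.1 ≤ b i + q.2}
  have hSclosed : IsClosed S := by
    refine IsClosed.inter (isClosed_le continuous_const continuous_snd) (IsClosed.inter (isClosed_le
      (f := fun q : E × ℝ => ‖x - q.1‖) (g := fun q => κ * (δ - q.2)) (by fun_prop) (by fun_prop))
      ?_)
    change IsClosed {q : E × ℝ | ∀ i, l i q.1 ≤ b i + q.2}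
    rw [Set.ofPred_forall]
    exact isClosed_iInter fun i => isClosed_le ((hl i).comp continuous_fst) (by fun_prop)
  have hSsub : S ⊆ Metric.closedBall x (κ * δ) ×ˢ Set.Icc 0 δ := by
    rintro ⟨y, s⟩ ⟨h0, h1, -⟩
    simp only at h0 h1
    refine ⟨?_, h0, ?_⟩
    · rw [Metric.mem_closedBall, dist_comm, dist_eq_norm]
      nlinarith
    · have := (norm_nonneg _).trans h1
      have := nonneg_of_mul_nonneg_right this hκ
      simp only
      linarith
  have hScomp : IsCompact S := by
    have : ProperSpace E := FiniteDimensional.proper ℝ E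
    exact ((isCompact_closedBall x (κ * δ)).prod isCompact_Icc).of_isClosed_subset hSclosed hSsub
  have hSne : S.Nonempty := ⟨(x, δ), hδ, by simp, hx⟩
  obtain ⟨⟨p, s⟩, ⟨hs, hps, hpl⟩, hmin⟩ := hScomp.exists_isMinOn hSne continuous_snd.continuousOn
  simp only at hs hps hpl
  rcases hs.eq_or_lt with h0 | hspos
  · subst h0
    exact ⟨p, by simpa using hpl, by simpa using hps⟩
  exfalso
  let I : Finset ι := Finset.univ.filter fun i => l i p = b i + s
  have hdI : ∀ i ∈ I, l i (d I) ≤ -1 := by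
    refine hd I ⟨s⁻¹ • (x₀ - p), fun i hi => ?_⟩
    have hi' : l i p = b i + s := (Finset.mem_filter.1 hi).2
    have h1 := hx₀ i
    rw [map_smul, map_sub, smul_eq_mul, hi', inv_mul_le_iff₀ hspos]
    linarith
  have hev : ∀ᶠ t : ℝ in nhdsWithin 0 (Set.Ioi 0), ∀ i, l i (p + t • d I) ≤ b i + (s - t) := by
    rw [Filter.eventually_all]
    intro i
    by_cases hi : i ∈ I
    · have hi' : l i p = b i + s := (Finset.mem_filter.1 hi).2
      filter_upwards [self_mem_nhdsWithin] with t ht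
      have ht : 0 < t := ht
      have := hdI i hi
      rw [map_add, map_smul, smul_eq_mul, hi']
      nlinarith
    · have hlt : l i p < b i + s := lt_of_le_of_ne (hpl i) fun h => hi (by simp [I, h])
      refine nhdsWithin_le_nhds ?_
      have hc1 : Continuous fun t : ℝ => l i (p + t • d I) := (hl i).comp (by fun_prop)
      have hc2 : Continuous fun t : ℝ => b i + (s - t) := by fun_prop
      have := (hc1.tendsto 0).eventually_lt (hc2.tendsto 0) (by simpa using hlt)
      filter_upwards [this] with t ht using ht.le
  have hts : ∀ᶠ t : ℝ in nhdsWithin 0 (Set.Ioi 0), t ∈ Set.Ioo 0 s := Ioo_mem_nhdsGT hspos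
  obtain ⟨t, ht1, ht2⟩ := (hev.and hts).exists
  have hmem : (p + t • d I, s - t) ∈ S := by
    refine ⟨by simpa using ht2.2.le, ?_, ht1⟩
    have h1 : ‖x - (p + t • d I)‖ ≤ ‖x - p‖ + t * ‖d I‖ := by
      calc ‖x - (p + t • d I)‖ = ‖(x - p) - t • d I‖ := by rw [sub_sub]
        _ ≤ ‖x - p‖ + ‖t • d I‖ := norm_sub_le _ _
        _ = _ := by rw [norm_smul, Real.norm_of_nonneg ht2.1.le]
    have h2 := mul_le_mul_of_nonneg_left (hdκ I) ht2.1.le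
    simp only
    nlinarith
  have := hmin hmem
  simp only [Set.mem_ofPred_eq] at this
  linarith [ht2.1]

end Hoffman

/-- Metric subregularity follows from a pointwise estimate by actual elements of the set of
solutions and of the values of the operator. -/
theorem metricallySubregularAt_of_exists_norm_sub_le {X Y : Type*} [NormedAddCommGroup X]
    [NormedAddCommGroup Y] {T : X → Set Y} {x₀ : X} {y₀ : Y} (h₀ : y₀ ∈ T x₀) (κ : ℝ) (hκ : 0 < κ)
    (h : ∀ᶠ x in nhds x₀, ∀ y ∈ T x, ∃ p, y₀ ∈ T p ∧ ‖x - p‖ ≤ κ * ‖y - y₀‖) :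
    MetricallySubregularAt T x₀ y₀ := by
  refine ⟨h₀, κ.toNNReal, Real.toNNReal_pos.2 hκ, _, h, fun x hx => ?_⟩
  rw [Metric.infEDist, Metric.infEDist, ENNReal.mul_iInf_of_ne (by simpa using hκ) (by simp)]
  refine le_iInf fun y => ?_
  by_cases hy : y ∈ T x
  · obtain ⟨p, hp, hxp⟩ := hx y hy
    simp only [hy, iInf_true]
    refine (iInf₂_le p hp).trans ?_
    rw [edist_eq_enorm_sub, edist_comm y₀ y, edist_eq_enorm_sub, ← ofReal_norm, ← ofReal_norm]
    change _ ≤ ENNReal.ofReal κ * _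
    rw [← ENNReal.ofReal_mul hκ.le]
    exact ENNReal.ofReal_le_ofReal hxp
  · simp only [hy, iInf_false]
    rw [ENNReal.mul_top (by simpa using hκ)]
    exact le_top

section Polyhedral

variable {X : Type*} [NormedAddCommGroup X] [NormedSpace ℝ X] [FiniteDimensional ℝ X]
  {Y : Type*} [NormedAddCommGroup Y] [NormedSpace ℝ Y] [FiniteDimensional ℝ Y]

/-- The estimate of metric subregularity along one polyhedral piece `P` of a graph. The solution
provided is the base point itself when the base point of the graph is off the piece. -/
theorem IsPolyhedralSet.eventually_exists_norm_sub_le {P : Set (X × Y)} (hP : IsPolyhedralSet P)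
    (x₀ : X) (y₀ : Y) :
    ∃ κ : ℝ, 0 < κ ∧ ∀ᶠ x in nhds x₀, ∀ y, (x, y) ∈ P →
      ∃ p, (p = x₀ ∨ (p, y₀) ∈ P) ∧ ‖x - p‖ ≤ κ * ‖y - y₀‖ := by
  obtain ⟨k, l, b, rfl⟩ := hP
  have hsplit : ∀ i x y, l i (x, y) = l i (x, 0) + l i (0, y) := fun i x y => by
    rw [← map_add]; simp
  by_cases h : (x₀, y₀) ∈ {q | ∀ i, l i q ≤ b i}
  · obtain ⟨κ, hκ, H⟩ := exists_hoffman_constant fun i => l i ∘ₗ LinearMap.inl ℝ X Y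
    let m : Fin k → Y →L[ℝ] ℝ := fun i => LinearMap.toContinuousLinearMap
      (l i ∘ₗ LinearMap.inr ℝ X Y)
    have hm : ∀ i y, l i (0, y) = m i y := fun i y => rfl
    let C : ℝ := 1 + ∑ i, ‖m i‖
    have hC0 : 0 ≤ ∑ i, ‖m i‖ := Finset.sum_nonneg fun _ _ => norm_nonneg _
    refine ⟨κ * C, by positivity, Filter.Eventually.of_forall fun x y hxy => ?_⟩
    obtain ⟨p, hp, hxp⟩ := H (fun i => b i - l i (0, y₀)) ⟨x₀, fun i => by
      have := h i
      rw [hsplit] at this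
      simp only [LinearMap.comp_apply, LinearMap.inl_apply]
      linarith⟩ x (C * ‖y - y₀‖) (by positivity) fun i => by
        have h1 := hxy i
        have h2 : -(m i (y - y₀)) ≤ ‖m i‖ * ‖y - y₀‖ :=
          (neg_le_abs _).trans ((m i).le_opNorm _)
        have h3 : ‖m i‖ ≤ C := by
          have := Finset.single_le_sum (f := fun i => ‖m i‖) (fun _ _ => norm_nonneg _)
            (Finset.mem_univ i)
          simp only [C] at this ⊢
          linarith
        have h4 := mul_le_mul_of_nonneg_right h3 (norm_nonneg (y - y₀))
        rw [hsplit, hm] at h1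
        rw [map_sub] at h2
        simp only [LinearMap.comp_apply, LinearMap.inl_apply, hm]
        linarith
    refine ⟨p, Or.inr fun i => ?_, by rw [mul_assoc]; exact hxp⟩
    have := hp i
    simp only [LinearMap.comp_apply, LinearMap.inl_apply] at this
    rw [hsplit]
    linarith
  · have hclosed : IsClosed {q : X × Y | ∀ i, l i q ≤ b i} := by
      rw [Set.ofPred_forall]
      exact isClosed_iInter fun i =>
        isClosed_le (l i).continuous_of_finiteDimensional continuous_const
    obtain ⟨ε, hε, hball⟩ := Metric.isOpen_iff.1 hclosed.isOpen_compl _ h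
    refine ⟨1, one_pos, ?_⟩
    filter_upwards [Metric.ball_mem_nhds x₀ hε] with x hx y hxy
    refine ⟨x₀, Or.inl rfl, ?_⟩
    rw [one_mul, ← dist_eq_norm, ← dist_eq_norm]
    have hle : ε ≤ dist y y₀ := by
      by_contra! hlt
      exact hball (by rw [Metric.mem_ball, Prod.dist_eq]; exact max_lt hx hlt) hxy
    exact (Metric.mem_ball.1 hx).le.trans hle

/-- **Robinson's theorem**, in the form needed here: polyhedral operators are metrically
subregular. -/
theorem IsPolyhedralOp.metricallySubregularAt {T : X → Set Y} (hT : IsPolyhedralOp T) {x₀ : X}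
    {y₀ : Y} (h₀ : y₀ ∈ T x₀) : MetricallySubregularAt T x₀ y₀ := by
  obtain ⟨k, P, hP, hgraph⟩ := hT
  choose κ hκ H using fun j => (hP j).eventually_exists_norm_sub_le x₀ y₀
  have hκ0 : 0 ≤ ∑ j, κ j := Finset.sum_nonneg fun j _ => (hκ j).le
  refine metricallySubregularAt_of_exists_norm_sub_le h₀ (1 + ∑ j, κ j) (by positivity) ?_
  filter_upwards [Filter.eventually_all.2 H] with x hx y hy
  have hxy : (x, y) ∈ ⋃ j, P j := hgraph ▸ hy
  obtain ⟨j, hj⟩ := Set.mem_iUnion.1 hxy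
  obtain ⟨p, hp, hle⟩ := hx j y hj
  refine ⟨p, ?_, hle.trans (mul_le_mul_of_nonneg_right ?_ (norm_nonneg _))⟩
  · rcases hp with rfl | hp
    · exact h₀
    · have : (p, y₀) ∈ opGraph T := hgraph ▸ Set.mem_iUnion.2 ⟨j, hp⟩
      exact this
  · have := Finset.single_le_sum (f := κ) (fun j _ => (hκ j).le) (Finset.mem_univ j)
    linarith

end Polyhedral

/-- Polyhedral sets are stable under preimages by affine maps `x ↦ f x + c`. -/
theorem IsPolyhedralSet.preimage_add_const {E F : Type*} [AddCommGroup E] [Module ℝ E]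
    [AddCommGroup F] [Module ℝ F] {s : Set F} (hs : IsPolyhedralSet s) (f : E →ₗ[ℝ] F) (c : F) :
    IsPolyhedralSet {x | f x + c ∈ s} := by
  obtain ⟨k, l, b, rfl⟩ := hs
  refine ⟨k, fun i => l i ∘ₗ f, fun i => b i - l i c, ?_⟩
  ext x
  simp [le_sub_iff_add_le]

/-- The sum of a polyhedral operator and an affine map is polyhedral. -/
theorem IsPolyhedralOp.opAdd_affine {X Y : Type*} [AddCommGroup X] [Module ℝ X] [AddCommGroup Y]
    [Module ℝ Y] {A : X → Set Y} (hA : IsPolyhedralOp A) (g : X →ᵃ[ℝ] Y) :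
    IsPolyhedralOp (opAdd A g) := by
  obtain ⟨k, P, hP, hgraph⟩ := hA
  let f : X × Y →ₗ[ℝ] X × Y := LinearMap.prod (LinearMap.fst ℝ X Y)
    (LinearMap.snd ℝ X Y - g.linear ∘ₗ LinearMap.fst ℝ X Y)
  have hf : ∀ q : X × Y, f q + (0, -g 0) = (q.1, q.2 - g q.1) := by
    rintro ⟨x, y⟩
    have := congrFun g.decomp x
    simp only [Pi.add_apply] at this
    ext
    · simp [f]
    · simp only [f, this]
      simp
      abel
  refine ⟨k, fun j => {q | f q + (0, -g 0) ∈ P j}, fun j => (hP j).preimage_add_const _ _, ?_⟩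
  ext q
  have : q ∈ opGraph (opAdd A g) ↔ (q.1, q.2 - g q.1) ∈ opGraph A := by
    simp only [opGraph, opAdd, Set.mem_ofPred_eq]
    constructor
    · rintro ⟨a, ha, h⟩
      rw [h]
      simpa using ha
    · intro h
      exact ⟨_, h, by abel⟩
  rw [this, hgraph]
  simp only [Set.mem_iUnion, Set.mem_ofPred_eq, hf]

section StronglyMonotone

variable {Z : Type*} [NormedAddCommGroup Z] [InnerProductSpace ℝ Z]

theorem IsStronglyMonotoneOp.metricallySubregularAt {T : Z → Set Z} (hT : IsStronglyMonotoneOp T)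
    {z₀ : Z} (h₀ : 0 ∈ T z₀) : MetricallySubregularAt T z₀ 0 := by
  obtain ⟨α, hα, h⟩ := hT
  refine metricallySubregularAt_of_exists_norm_sub_le h₀ α⁻¹ (inv_pos.2 hα)
    (Filter.Eventually.of_forall fun z u hu => ⟨z₀, h₀, ?_⟩)
  have h1 := h z z₀ u 0 hu h₀
  have h2 := real_inner_le_norm (z - z₀) (u - 0)
  rw [le_inv_mul_iff₀ hα]
  rcases (norm_nonneg (z - z₀)).eq_or_lt with h0 | hpos
  · rw [← h0, mul_zero]; exact norm_nonneg _
  · nlinarith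

end StronglyMonotone

/-! ### Composite operators and quadratic growth -/

section StrongConvexity

variable {Y : Type*} [NormedAddCommGroup Y] [InnerProductSpace ℝ Y] [CompleteSpace Y]

theorem StrongConvexOn.inner_gradient_add_le {f : Y → ℝ} {μ : ℝ}
    (hf : StrongConvexOn Set.univ μ f) (hd : Differentiable ℝ f) (x y : Y) :
    f x + inner ℝ (gradient f x) (y - x) + μ / 2 * ‖x - y‖ ^ 2 ≤ f y := by
  have hline : HasDerivAt (fun t : ℝ => x + t • (y - x)) (y - x) 0 := by
    simpa using ((hasDerivAt_id (0 : ℝ)).smul_const (y - x)).const_add x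
  have hderiv : HasDerivAt (fun t : ℝ => f (x + t • (y - x))) (inner ℝ (gradient f x) (y - x)) 0 := by
    have h1 : HasFDerivAt f (InnerProductSpace.toDual ℝ Y (gradient f x))
        ((fun t : ℝ => x + t • (y - x)) 0) := by
      simpa using (hd x).hasGradientAt.hasFDerivAt
    have h2 := h1.comp_hasDerivAt (0 : ℝ) hline
    rwa [InnerProductSpace.toDual_apply_apply] at h2
  -- Divide the inequality of strong convexity on the segment by `t` and let `t → 0+`.
  have hslope := hderiv.tendsto_slope_zero_right
  have hlim : Filter.Tendsto (fun t : ℝ => f y - f x - (1 - t) * (μ / 2 * ‖x - y‖ ^ 2))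
      (nhdsWithin 0 (Set.Ioi 0)) (nhds (f y - f x - (1 - 0) * (μ / 2 * ‖x - y‖ ^ 2))) :=
    (Continuous.tendsto (by fun_prop) 0).mono_left nhdsWithin_le_nhds
  have hle := le_of_tendsto_of_tendsto hslope hlim (by
    filter_upwards [Ioo_mem_nhdsGT (zero_lt_one' ℝ)] with t ht
    have h := hf.2 (Set.mem_univ x) (Set.mem_univ y) (sub_nonneg.2 ht.2.le) ht.1.le (by ring)
    have hpt : (1 - t) • x + t • y = x + t • (y - x) := by
      rw [sub_smul, smul_sub, one_smul]; abel
    rw [hpt] at h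
    simp only [smul_eq_mul] at h ⊢
    rw [zero_add, zero_smul, add_zero, inv_mul_le_iff₀ ht.1]
    nlinarith)
  linarith

/-- The gradient of a strongly convex function is strongly monotone. -/
theorem StrongConvexOn.mul_norm_sq_le_inner_gradient {f : Y → ℝ} {μ : ℝ}
    (hf : StrongConvexOn Set.univ μ f) (hd : Differentiable ℝ f) (x y : Y) :
    μ * ‖x - y‖ ^ 2 ≤ inner ℝ (gradient f x - gradient f y) (x - y) := by
  have h1 := hf.inner_gradient_add_le hd x y
  have h2 := hf.inner_gradient_add_le hd y x
  rw [norm_sub_rev y x] at h2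
  rw [← neg_sub x y, inner_neg_right] at h1
  rw [inner_sub_left]
  linarith

end StrongConvexity

section QuadraticGrowth

variable {Z : Type*} [NormedAddCommGroup Z] [InnerProductSpace ℝ Z]
  {Y : Type*} [NormedAddCommGroup Y] [InnerProductSpace ℝ Y]

/-- The quadratic growth condition at `z₀`, a zero of `∂φ + B`: near `z₀`, the squared distance to
the points `p` with `E p = E z₀` and `g ∈ ∂φ(p)`, where `g` stands for `-B z₀`, is controlled by
`‖E z - E z₀‖ ^ 2` and the gap `G` between `φ` and its affine minorant of slope `g` at `z₀`. -/
def QuadraticGrowthAt (φ : Z → EReal) (E : Z →ₗ[ℝ] Y) (g z₀ : Z) : Prop :=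
  ∃ κ : ℝ, 0 < κ ∧ ∀ᶠ z in nhds z₀, ∀ G : ℝ, 0 ≤ G →
    φ z = φ z₀ + ((inner ℝ g (z - z₀) + G : ℝ) : EReal) →
      ∃ p, E p = E z₀ ∧ g ∈ subdiffOp φ p ∧ ‖z - p‖ ^ 2 ≤ κ * (‖E z - E z₀‖ ^ 2 + G)

theorem ne_top_of_mem_subdiffOp {φ : Z → EReal} (htop : ∃ x, φ x ≠ ⊤)
    {x v : Z} (h : v ∈ subdiffOp φ x) : φ x ≠ ⊤ := by
  intro hx
  obtain ⟨y, hy⟩ := htop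
  have := h y
  rw [hx, EReal.top_add_coe] at this
  exact hy (top_le_iff.1 this)

/-- With `D = ‖z - p‖`, `e = ‖E z - E z₀‖` and `u ∈ ∂φ(z) + B z`, monotonicity gives
`μ e² + G ≤ ‖u‖ D`, while quadratic growth gives `D² ≤ κ (e² + G)`. -/
theorem QuadraticGrowthAt.metricallySubregularAt {φ : Z → EReal} (hbot : ∀ x, φ x ≠ ⊥)
    (htop : ∃ x, φ x ≠ ⊤) {E : Z →ₗ[ℝ] Y} {B : Z → Z} {μ : ℝ} (hμ : 0 < μ)
    (hBE : ∀ x y, E x = E y → B x = B y)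
    (hmono : ∀ x y, μ * ‖E x - E y‖ ^ 2 ≤ inner ℝ (B x - B y) (x - y)) {z₀ : Z}
    (h₀ : -B z₀ ∈ subdiffOp φ z₀) (hg : QuadraticGrowthAt φ E (-B z₀) z₀) :
    MetricallySubregularAt (opAdd (subdiffOp φ) B) z₀ 0 := by
  have hzero : ∀ p, E p = E z₀ → -B z₀ ∈ subdiffOp φ p → 0 ∈ opAdd (subdiffOp φ) B p := by
    intro p hp hgp
    exact ⟨_, hgp, by rw [hBE p z₀ hp, neg_add_cancel]⟩
  obtain ⟨κ, hκ, hev⟩ := hg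
  refine metricallySubregularAt_of_exists_norm_sub_le (hzero z₀ rfl h₀) (κ * (1 + μ⁻¹))
    (by positivity) ?_
  filter_upwards [hev] with z hz u hu
  obtain ⟨v, hv, rfl⟩ := hu
  set g := -B z₀ with hgdef
  obtain ⟨a, ha⟩ : ∃ a : ℝ, φ z₀ = a :=
    ⟨_, (EReal.coe_toReal (ne_top_of_mem_subdiffOp htop h₀) (hbot _)).symm⟩
  obtain ⟨b, hb⟩ : ∃ b : ℝ, φ z = b :=
    ⟨_, (EReal.coe_toReal (ne_top_of_mem_subdiffOp htop hv) (hbot _)).symm⟩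
  have hG := h₀ z
  rw [ha, hb, ← EReal.coe_add, EReal.coe_le_coe_iff] at hG
  obtain ⟨p, hEp, hgp, hp⟩ := hz (b - a - inner ℝ g (z - z₀)) (by linarith) (by
    rw [ha, hb, ← EReal.coe_add, EReal.coe_eq_coe_iff]; ring)
  obtain ⟨c, hc⟩ : ∃ c : ℝ, φ p = c :=
    ⟨_, (EReal.coe_toReal (ne_top_of_mem_subdiffOp htop hgp) (hbot _)).symm⟩
  refine ⟨p, hzero p hEp hgp, ?_⟩
  have h1 := hgp z₀
  have h2 := hv p
  have h3 := hmono z p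
  rw [hc, ha, ← EReal.coe_add, EReal.coe_le_coe_iff] at h1
  rw [hc, hb, ← EReal.coe_add, EReal.coe_le_coe_iff] at h2
  rw [hEp, hBE p z₀ hEp] at h3
  have hcs := real_inner_le_norm (v + B z) (z - p)
  rw [sub_zero]
  set D := ‖z - p‖
  set e := ‖E z - E z₀‖
  set U := ‖v + B z‖
  have e1 : (inner ℝ (v + B z) (z - p) : ℝ) = -inner ℝ v (p - z) + inner ℝ (B z) (z - p) := by
    rw [inner_add_left, ← inner_neg_right, neg_sub]
  have e2 : (inner ℝ g (z - z₀) : ℝ) = inner ℝ g (z - p) - inner ℝ g (z₀ - p) := by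
    rw [← inner_sub_right]; congr 1; abel
  have e3 : (inner ℝ (B z - B z₀) (z - p) : ℝ) = inner ℝ (B z) (z - p) + inner ℝ g (z - p) := by
    rw [hgdef, inner_neg_left, inner_sub_left]; ring
  set G := b - a - inner ℝ g (z - z₀) with hGdef
  have hkey : μ * e ^ 2 + G ≤ U * D := by linarith
  have hG0 : 0 ≤ G := by linarith
  have hUD : 0 ≤ U * D := by positivity
  have h4 : e ^ 2 + G ≤ (1 + μ⁻¹) * (U * D) := by
    have h5 : e ^ 2 ≤ μ⁻¹ * (U * D) := by
      rw [le_inv_mul_iff₀ hμ]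
      linarith
    have h6 : 0 ≤ μ * e ^ 2 := by positivity
    linarith
  have h7 : D ^ 2 ≤ κ * ((1 + μ⁻¹) * (U * D)) := hp.trans (mul_le_mul_of_nonneg_left h4 hκ.le)
  have hD : 0 ≤ D := norm_nonneg _
  rcases hD.eq_or_lt with h0 | hpos
  · rw [← h0]; positivity
  · refine le_of_mul_le_mul_right ?_ hpos
    calc D * D = D ^ 2 := by ring
      _ ≤ _ := h7
      _ = _ := by ring

end QuadraticGrowth

section Composite

variable {Z : Type*} [NormedAddCommGroup Z] [InnerProductSpace ℝ Z] [FiniteDimensional ℝ Z]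
  {Y : Type*} [NormedAddCommGroup Y] [InnerProductSpace ℝ Y] [FiniteDimensional ℝ Y]

/-- All that is used of an operator `B = E* ∇f(E ·) + c`: it factors through `E`, and is strongly
monotone relative to `E`. -/
theorem IsCompositeGradient.exists_strongly_monotone {B : Z → Z} (hB : IsCompositeGradient Y B) :
    ∃ (E : Z →ₗ[ℝ] Y) (μ : ℝ), 0 < μ ∧ (∀ x y, E x = E y → B x = B y) ∧
      ∀ x y, μ * ‖E x - E y‖ ^ 2 ≤ inner ℝ (B x - B y) (x - y) := by
  have : CompleteSpace Y := FiniteDimensional.complete ℝ Y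
  obtain ⟨f, E, c, ⟨μ, hμ, hf⟩, hd, -, hBE⟩ := hB
  refine ⟨E, μ, hμ, fun x y h => by rw [hBE, hBE, h], fun x y => ?_⟩
  have := hf.mul_norm_sq_le_inner_gradient hd (E x) (E y)
  rw [hBE, hBE, add_sub_add_right_eq_sub, ← map_sub (LinearMap.adjoint E),
    LinearMap.adjoint_inner_left, map_sub]
  exact this

/-- The points `p` with `E p = E z₀` and `g ∈ ∂φ(p)` form a polyhedron, to which Hoffman's bound
applies: its inequalities are violated at `z` by at most a multiple of the gap and of
`‖E z - E z₀‖`. -/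
theorem IsPolyhedralFun.quadraticGrowthAt {φ : Z → EReal} (hφ : IsPolyhedralFun φ) (E : Z →ₗ[ℝ] Y)
    {g z₀ : Z} (h₀ : g ∈ subdiffOp φ z₀) : QuadraticGrowthAt φ E g z₀ := by
  obtain ⟨hbot, htop, k, l, b, hepi⟩ := hφ
  obtain ⟨a, ha⟩ : ∃ a : ℝ, φ z₀ = a :=
    ⟨_, (EReal.coe_toReal (ne_top_of_mem_subdiffOp htop h₀) (hbot _)).symm⟩
  have hmem : ∀ (x : Z) (t : ℝ), φ x ≤ t ↔ ∀ i, l i (x, t) ≤ b i := by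
    intro x t
    have : (x, t) ∈ {q : Z × ℝ | φ q.1 ≤ (q.2 : EReal)} ↔ (x, t) ∈ {x | ∀ i, l i x ≤ b i} := by
      rw [hepi]
    exact this
  let o := stdOrthonormalBasis ℝ Y
  let J := Fin (Module.finrank ℝ Y)
  let γ : Z →ₗ[ℝ] Z × ℝ := LinearMap.prod LinearMap.id (innerSL ℝ g : Z →L[ℝ] ℝ).toLinearMap
  let τ : ℝ := a - inner ℝ g z₀
  have hγ : ∀ i x s, l i (x, a + (inner ℝ g (x - z₀) + s)) = l i (γ x) + τ * l i (0, 1)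
      + s * l i (0, 1) := by
    intro i x s
    have : ((x, a + (inner ℝ g (x - z₀) + s)) : Z × ℝ) = γ x + τ • (0, 1) + s • (0, 1) := by
      ext
      · simp [γ]
      · simp [γ, τ, inner_sub_right]; ring
    rw [this, map_add, map_add, map_smul, map_smul, smul_eq_mul, smul_eq_mul]
  let f : J → Z →ₗ[ℝ] ℝ := fun j => (innerSL ℝ (o j) : Y →L[ℝ] ℝ).toLinearMap ∘ₗ E
  have hf : ∀ j x, f j x = inner ℝ (o j) (E x) := fun j x => rfl
  let ℓ : (Fin k ⊕ J) ⊕ J → Z →ₗ[ℝ] ℝ := Sum.elim (Sum.elim (fun i => l i ∘ₗ γ) f) fun j => -f j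
  obtain ⟨κ, hκ, H⟩ := exists_hoffman_constant ℓ
  let β : (Fin k ⊕ J) ⊕ J → ℝ := Sum.elim (Sum.elim (fun i => b i - τ * l i (0, 1))
    (fun j => f j z₀)) fun j => -f j z₀
  have hfeas : ∀ p, (∀ i, ℓ i p ≤ β i) ↔ φ p ≤ ((a + inner ℝ g (p - z₀) : ℝ) : EReal) ∧
      E p = E z₀ := by
    intro p
    have h1 : φ p ≤ ((a + inner ℝ g (p - z₀) : ℝ) : EReal) ↔
        ∀ i, l i (γ p) ≤ b i - τ * l i (0, 1) := by
      rw [hmem]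
      refine forall_congr' fun i => ?_
      have := hγ i p 0
      rw [add_zero, zero_mul, add_zero] at this
      rw [this, le_sub_iff_add_le]
    have h2 : E p = E z₀ ↔ ∀ j, f j p = f j z₀ := by
      refine ⟨fun h j => by rw [hf, hf, h], fun h => ?_⟩
      exact InnerProductSpace.ext_inner_left_basis o.toBasis fun j => by simpa [hf] using h j
    rw [h1, h2]
    constructor
    · intro h
      refine ⟨fun i => h (Sum.inl (Sum.inl i)), fun j => le_antisymm (h (Sum.inl (Sum.inr j))) ?_⟩
      have : -f j p ≤ -f j z₀ := h (Sum.inr j)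
      linarith
    · rintro ⟨h, h'⟩ ((i | j) | j)
      · exact h i
      · exact (h' j).le
      · exact neg_le_neg (h' j).ge
  have hsub : ∀ p, φ p ≤ ((a + inner ℝ g (p - z₀) : ℝ) : EReal) → g ∈ subdiffOp φ p := by
    intro p hp y
    refine le_trans ?_ (h₀ y)
    refine (add_le_add_left hp _).trans ?_
    rw [ha, ← EReal.coe_add, ← EReal.coe_add, EReal.coe_le_coe_iff, add_assoc, ← inner_add_right]
    apply le_of_eq
    congr 2
    abel
  let C : ℝ := 1 + ∑ i, |l i (0, 1)|
  have hC0 : 0 ≤ ∑ i, |l i (0, 1)| := Finset.sum_nonneg fun _ _ => abs_nonneg _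
  have hC : ∀ i, l i (0, 1) ≥ -C := by
    intro i
    have := Finset.single_le_sum (f := fun i => |l i (0, 1)|) (fun _ _ => abs_nonneg _)
      (Finset.mem_univ i)
    have := neg_abs_le (l i (0, 1))
    simp only [C]
    linarith
  refine ⟨1 + 2 * (κ * C) ^ 2, by positivity, ?_⟩
  filter_upwards [Metric.ball_mem_nhds z₀ one_pos] with z hz G hG hφz
  -- Hoffman's bound is linear in the gap `G`, which is at most its square root when `G ≤ 1`.
  rcases le_total 1 G with h1 | h1
  · refine ⟨z₀, rfl, h₀, ?_⟩
    have hz1 : ‖z - z₀‖ < 1 := by simpa [dist_eq_norm] using hz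
    have h2 : 0 ≤ ‖z - z₀‖ := norm_nonneg _
    have h3 : 0 ≤ (κ * C) ^ 2 * (‖E z - E z₀‖ ^ 2 + G) := by positivity
    have h4 := sq_nonneg ‖E z - E z₀‖
    nlinarith
  set e := ‖E z - E z₀‖ with he
  have he0 : 0 ≤ e := norm_nonneg _
  obtain ⟨p, hp, hzp⟩ := H β ⟨z₀, (hfeas z₀).2 ⟨by simp [ha], rfl⟩⟩ z (C * (e + G))
    (by positivity) (by
      have hCe : e ≤ C * (e + G) := by
        have : 0 ≤ (∑ i, |l i (0, 1)|) * (e + G) := by positivity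
        simp only [C]
        nlinarith
      have hj : ∀ j, |f j z - f j z₀| ≤ e := by
        intro j
        rw [hf, hf, ← inner_sub_right]
        refine (abs_real_inner_le_norm _ _).trans ?_
        rw [o.norm_eq_one, one_mul]
      rintro ((i | j) | j)
      · have h2 : φ z ≤ ((a + (inner ℝ g (z - z₀) + G) : ℝ) : EReal) := by
          rw [hφz, ha, ← EReal.coe_add]
        have h3 := (hmem _ _).1 h2 i
        rw [hγ] at h3
        have h4 := mul_le_mul_of_nonneg_left (hC i) hG
        change l i (γ z) ≤ b i - τ * l i (0, 1) + _
        have h5 : 0 ≤ C * e := by positivity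
        linarith
      · have := (abs_le.1 (hj j)).2
        change f j z ≤ f j z₀ + _
        linarith
      · have := (abs_le.1 (hj j)).1
        change -f j z ≤ -f j z₀ + _
        linarith)
  obtain ⟨hp1, hp2⟩ := (hfeas p).1 hp
  refine ⟨p, hp2, hsub p hp1, ?_⟩
  calc ‖z - p‖ ^ 2 ≤ (κ * (C * (e + G))) ^ 2 := by gcongr
    _ = (κ * C) ^ 2 * (e + G) ^ 2 := by ring
    _ ≤ (κ * C) ^ 2 * (2 * (e ^ 2 + G)) := by
        gcongr
        nlinarith [sq_nonneg (e - G)]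
    _ ≤ (1 + 2 * (κ * C) ^ 2) * (e ^ 2 + G) := by
        have : 0 ≤ e ^ 2 + G := by positivity
        linarith

end Composite

/-! ### Quadratic growth of `ℓ_p` norms -/

section Sublinear

variable {Z : Type*} [NormedAddCommGroup Z] [InnerProductSpace ℝ Z]

/-- Subgradients of a sublinear function. -/
theorem mem_subdiffOp_iff_of_sublinear {N : Z → ℝ} (hhom : ∀ (t : ℝ) x, 0 ≤ t → N (t • x) = t * N x)
    (hadd : ∀ x y, N (x + y) ≤ N x + N y) {g x : Z} :
    g ∈ subdiffOp (fun z => (N z : EReal)) x ↔ (∀ y, inner ℝ g y ≤ N y) ∧ N x = inner ℝ g x := by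
  have key : g ∈ subdiffOp (fun z => (N z : EReal)) x ↔ ∀ y, N x + inner ℝ g (y - x) ≤ N y := by
    refine forall_congr' fun y => ?_
    rw [← EReal.coe_add, EReal.coe_le_coe_iff]
  have h0 : N 0 = 0 := by simpa using hhom 0 0 le_rfl
  rw [key]
  constructor
  · intro h
    have h1 : ∀ y, inner ℝ g y ≤ N y := by
      intro y
      have h1 := h (x + y)
      have h2 := hadd x y
      rw [add_sub_cancel_left] at h1
      linarith
    refine ⟨h1, le_antisymm ?_ (h1 x)⟩
    have := h 0
    rw [h0, zero_sub, inner_neg_right] at this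
    linarith
  · rintro ⟨h1, h2⟩ y
    rw [h2, inner_sub_right]
    linarith [h1 y]

variable [FiniteDimensional ℝ Z] {Y : Type*} [NormedAddCommGroup Y] [InnerProductSpace ℝ Y]

/-- A norm `N` whose modulus of convexity is at least quadratic has quadratic growth: the solutions
of `g ∈ ∂N(p)` are the multiples `s w`, `0 ≤ s`, of at most one unit vector `w`, and uniform
convexity bounds the gap `N z - ⟪g, z⟫` below by `c / N z * ‖z - N z • w‖ ^ 2`. -/
theorem quadraticGrowthAt_of_uniformly_convex {N : Z → ℝ}
    (hhom : ∀ (t : ℝ) x, 0 ≤ t → N (t • x) = t * N x)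
    (hadd : ∀ x y, N (x + y) ≤ N x + N y) (hpos : ∀ x, x ≠ 0 → 0 < N x) (hcont : Continuous N)
    {c : ℝ} (hc : 0 < c) (huc : ∀ z w, N z = 1 → N w = 1 → N (z + w) ≤ 2 - c * ‖z - w‖ ^ 2)
    (E : Z →ₗ[ℝ] Y) {g z₀ : Z} (h₀ : g ∈ subdiffOp (fun z => (N z : EReal)) z₀) :
    QuadraticGrowthAt (fun z => (N z : EReal)) E g z₀ := by
  have hN0 : N 0 = 0 := by simpa using hhom 0 0 le_rfl
  have hNnn : ∀ x, 0 ≤ N x := fun x => by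
    by_cases hx : x = 0
    · rw [hx, hN0]
    · exact (hpos x hx).le
  have hiff := fun x => mem_subdiffOp_iff_of_sublinear hhom hadd (g := g) (x := x)
  obtain ⟨hgN, hgz₀⟩ := (hiff z₀).1 h₀
  have hgap : ∀ z G, (N z : EReal) = (N z₀ : EReal) + ((inner ℝ g (z - z₀) + G : ℝ) : EReal) →
      G = N z - inner ℝ g z := by
    intro z G h
    rw [← EReal.coe_add, EReal.coe_eq_coe_iff, inner_sub_right] at h
    linarith
  by_cases hw : ∃ w, N w = 1 ∧ inner ℝ g w = 1
  · obtain ⟨w, hNw, hgw⟩ := hw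
    have hray : ∀ z, c * ‖z - N z • w‖ ^ 2 ≤ N z * (N z - inner ℝ g z) := by
      intro z
      by_cases hz : z = 0
      · simp [hz, hN0]
      have hs := hpos z hz
      have h1 : N ((N z)⁻¹ • z) = 1 := by
        rw [hhom _ _ (inv_nonneg.2 hs.le), inv_mul_cancel₀ hs.ne']
      have h2 := huc _ w h1 hNw
      have h3 := hgN ((N z)⁻¹ • z + w)
      rw [inner_add_right, hgw, real_inner_smul_right] at h3
      have h4 : (N z)⁻¹ • z - w = (N z)⁻¹ • (z - N z • w) := by
        rw [smul_sub, smul_smul, inv_mul_cancel₀ hs.ne', one_smul]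
      rw [h4, norm_smul, norm_inv, Real.norm_of_nonneg hs.le, mul_pow] at h2
      have h5 : c * ((N z)⁻¹ ^ 2 * ‖z - N z • w‖ ^ 2) ≤ 1 - (N z)⁻¹ * inner ℝ g z := by linarith
      have h6 := mul_le_mul_of_nonneg_left h5 (sq_nonneg (N z))
      have e1 : N z ^ 2 * (c * ((N z)⁻¹ ^ 2 * ‖z - N z • w‖ ^ 2)) = c * ‖z - N z • w‖ ^ 2 := by
        field_simp
      have e2 : N z ^ 2 * (1 - (N z)⁻¹ * inner ℝ g z) = N z * (N z - inner ℝ g z) := by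
        field_simp
      rwa [e1, e2] at h6
    have hz₀w : z₀ = N z₀ • w := by
      have := hray z₀
      rw [hgz₀, sub_self, mul_zero, ← hgz₀] at this
      have h2 : ‖z₀ - N z₀ • w‖ ^ 2 ≤ 0 := by
        by_contra! h
        have := mul_pos hc h
        linarith
      exact sub_eq_zero.1 (norm_eq_zero.1 (pow_eq_zero_iff two_ne_zero |>.1
        (le_antisymm h2 (sq_nonneg _))))
    set R := N z₀ + 1 with hRdef
    have hR : 0 < R := by have := hNnn z₀; linarith
    have hnear : ∀ᶠ z in nhds z₀, N z < R :=
      (hcont.tendsto z₀).eventually_lt_const (by linarith)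
    have hclose : ∀ z G, N z < R → 0 ≤ G → G = N z - inner ℝ g z →
        ‖z - N z • w‖ ^ 2 ≤ R / c * G := by
      intro z G hz hG hGz
      have := hray z
      rw [← hGz] at this
      rw [div_mul_eq_mul_div, le_div_iff₀ hc, mul_comm]
      exact this.trans (mul_le_mul_of_nonneg_right hz.le hG)
    by_cases hEw : E w = 0
    · refine ⟨R / c, by positivity, ?_⟩
      filter_upwards [hnear] with z hz G hG hφ
      refine ⟨N z • w, ?_, (hiff _).2 ⟨hgN, ?_⟩, ?_⟩
      · rw [hz₀w, map_smul, map_smul, hEw, smul_zero, smul_zero]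
      · rw [hhom _ _ (hNnn z), hNw, real_inner_smul_right, hgw]
      · refine (hclose z G hz hG (hgap z G hφ)).trans ?_
        have : 0 ≤ R / c * ‖E z - E z₀‖ ^ 2 := by positivity
        linarith
    · have hEw' : 0 < ‖E w‖ := norm_pos_iff.2 hEw
      let E' := LinearMap.toContinuousLinearMap E
      have hE' : ∀ x, ‖E x‖ ≤ ‖E'‖ * ‖x‖ := fun x => E'.le_opNorm x
      set b := ‖w‖ / ‖E w‖ with hb
      set a := 1 + ‖E'‖ * b with ha
      refine ⟨2 * a ^ 2 * (R / c) + 2 * b ^ 2 + 1, by positivity, ?_⟩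
      filter_upwards [hnear] with z hz G hG hφ
      refine ⟨z₀, rfl, h₀, ?_⟩
      have hr := hclose z G hz hG (hgap z G hφ)
      set r := z - N z • w with hrdef
      set e := ‖E z - E z₀‖ with he
      have h1 : |N z - N z₀| * ‖E w‖ ≤ e + ‖E'‖ * ‖r‖ := by
        have : (N z - N z₀) • E w = (E z - E z₀) - E r := by
          have h2 : E z₀ = N z₀ • E w := by rw [← map_smul, ← hz₀w]
          rw [hrdef, map_sub, map_smul, sub_smul, h2]
          abel
        rw [← Real.norm_eq_abs, ← norm_smul, this]
        exact (norm_sub_le _ _).trans (add_le_add_right (hE' r) _)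
      have h2 : |N z - N z₀| * ‖w‖ ≤ b * (e + ‖E'‖ * ‖r‖) := by
        have h3 : |N z - N z₀| * ‖w‖ = b * (|N z - N z₀| * ‖E w‖) := by
          rw [hb]; field_simp
        rw [h3]
        exact mul_le_mul_of_nonneg_left h1 (by positivity)
      have h3 : ‖z - z₀‖ ≤ a * ‖r‖ + b * e := by
        have : z - z₀ = r + (N z - N z₀) • w := by
          nth_rewrite 1 [hz₀w]
          rw [hrdef, sub_smul]; abel
        rw [this]
        refine (norm_add_le _ _).trans ?_
        rw [norm_smul, Real.norm_eq_abs]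
        linarith
      calc ‖z - z₀‖ ^ 2 ≤ (a * ‖r‖ + b * e) ^ 2 := by gcongr
        _ ≤ 2 * a ^ 2 * ‖r‖ ^ 2 + 2 * b ^ 2 * e ^ 2 := by
          nlinarith [sq_nonneg (a * ‖r‖ - b * e)]
        _ ≤ 2 * a ^ 2 * (R / c * G) + 2 * b ^ 2 * e ^ 2 := by gcongr
        _ ≤ _ := by
          have e1 : 0 ≤ 2 * a ^ 2 * (R / c) * e ^ 2 := by positivity
          have e2 : 0 ≤ 2 * b ^ 2 * G := by positivity
          have e3 : 0 ≤ e ^ 2 := by positivity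
          nlinarith
  · -- Here `g` is in the interior of the dual ball, `z₀ = 0`, and the gap grows linearly.
    have hz₀ : z₀ = 0 := by
      by_contra hne
      have hs := hpos z₀ hne
      refine hw ⟨(N z₀)⁻¹ • z₀, ?_, ?_⟩
      · rw [hhom _ _ (inv_nonneg.2 hs.le), inv_mul_cancel₀ hs.ne']
      · rw [real_inner_smul_right, ← hgz₀, inv_mul_cancel₀ hs.ne']
    have hpos' : ∀ z, z ≠ 0 → 0 < N z - inner ℝ g z := by
      intro z hz
      refine sub_pos.2 (lt_of_le_of_ne (hgN z) fun h => hw ⟨(N z)⁻¹ • z, ?_, ?_⟩)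
      · rw [hhom _ _ (inv_nonneg.2 (hNnn z)), inv_mul_cancel₀ (hpos z hz).ne']
      · rw [real_inner_smul_right, h, inv_mul_cancel₀ (hpos z hz).ne']
    obtain ⟨κ, hκ, hgrow⟩ : ∃ κ : ℝ, 0 < κ ∧ ∀ z, ‖z‖ ≤ κ * (N z - inner ℝ g z) := by
      rcases subsingleton_or_nontrivial Z with hZ | hZ
      · exact ⟨1, one_pos, fun z => by simp [Subsingleton.elim z 0, hN0]⟩
      have : ProperSpace Z := FiniteDimensional.proper ℝ Z
      obtain ⟨z₁, hz₁, hmin⟩ := (isCompact_sphere (0 : Z) 1).exists_isMinOn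
        (NormedSpace.sphere_nonempty.2 zero_le_one)
        (f := fun z => N z - inner ℝ g z) (by fun_prop)
      have hz₁0 : z₁ ≠ 0 := fun h => by simp [h] at hz₁
      have hm := hpos' z₁ hz₁0
      refine ⟨(N z₁ - inner ℝ g z₁)⁻¹, inv_pos.2 hm, fun z => ?_⟩
      rw [le_inv_mul_iff₀ hm]
      by_cases hz : z = 0
      · simp [hz, hN0]
      have hz' := norm_pos_iff.2 hz
      have h1 := hmin (show ‖z‖⁻¹ • z ∈ Metric.sphere (0 : Z) 1 by
        simp [norm_smul, hz'.ne'])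
      simp only [Set.mem_ofPred_eq] at h1
      rw [hhom _ _ (inv_nonneg.2 hz'.le), real_inner_smul_right, ← mul_sub,
        le_inv_mul_iff₀ hz', mul_comm] at h1
      exact h1
    refine ⟨κ, hκ, ?_⟩
    filter_upwards [Metric.ball_mem_nhds z₀ one_pos] with z hz G hG hφ
    refine ⟨z₀, rfl, h₀, ?_⟩
    have h1 := hgrow z
    rw [← hgap z G hφ] at h1
    rw [hz₀, mem_ball_zero_iff] at hz
    have h2 : 0 ≤ κ * ‖E z - E z₀‖ ^ 2 := by positivity
    have h3 := norm_nonneg z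
    rw [hz₀, sub_zero, ← hz₀]
    nlinarith

end Sublinear

section ScalarPower

/-- On `[-1, 1]`, the function `|t| ^ q - q (q - 1) / 2 * t ^ 2` is (midpoint) convex. -/
theorem abs_midpoint_rpow_le {q : ℝ} (hq1 : 1 < q) (hq2 : q ≤ 2) {a b : ℝ} (ha : |a| ≤ 1)
    (hb : |b| ≤ 1) :
    |(a + b) / 2| ^ q ≤ (|a| ^ q + |b| ^ q) / 2 - q * (q - 1) / 8 * (a - b) ^ 2 := by
  set k : ℝ := q * (q - 1) / 2 with hk
  let h : ℝ → ℝ := fun t => t ^ q - k * t ^ 2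
  have hcont : ContinuousOn h (Set.Icc 0 1) := by
    refine ContinuousOn.sub (ContinuousOn.rpow_const continuousOn_id fun t _ => Or.inr (by linarith))
      (by fun_prop)
  have hd1 : ∀ t ∈ Set.Ioo (0 : ℝ) 1, HasDerivAt h (q * t ^ (q - 1) - k * (2 * t)) t := by
    intro t ht
    have := (Real.hasDerivAt_rpow_const (p := q) (Or.inl ht.1.ne')).sub
      (((hasDerivAt_id t).pow 2).const_mul k)
    refine this.congr_deriv ?_
    simp
  have hd2 : ∀ t ∈ Set.Ioo (0 : ℝ) 1, HasDerivAt (fun t : ℝ => q * t ^ (q - 1) - k * (2 * t))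
      (q * ((q - 1) * t ^ (q - 2)) - k * 2) t := by
    intro t ht
    have h1 := ((Real.hasDerivAt_rpow_const (x := t) (p := q - 1) (Or.inl ht.1.ne')).const_mul q).sub
      (((hasDerivAt_id t).const_mul 2).const_mul k)
    have e : q - 1 - 1 = q - 2 := by ring
    rw [e] at h1
    refine h1.congr_deriv ?_
    simp
  have hpow : ∀ t ∈ Set.Ioo (0 : ℝ) 1, 1 ≤ t ^ (q - 2) := fun t ht =>
    Real.one_le_rpow_of_pos_of_le_one_of_nonpos ht.1 ht.2.le (by linarith)
  have hint : interior (Set.Icc (0 : ℝ) 1) = Set.Ioo 0 1 := interior_Icc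
  have hconv : ConvexOn ℝ (Set.Icc 0 1) h := by
    refine convexOn_of_hasDerivWithinAt2_nonneg (convex_Icc 0 1) hcont
      (f' := fun t => q * t ^ (q - 1) - k * (2 * t))
      (f'' := fun t => q * ((q - 1) * t ^ (q - 2)) - k * 2) ?_ ?_ ?_
    · intro t ht
      rw [hint] at ht
      exact (hd1 t ht).hasDerivWithinAt
    · intro t ht
      rw [hint] at ht
      exact (hd2 t ht).hasDerivWithinAt
    · intro t ht
      rw [hint] at ht
      have h1 := hpow t ht
      have h2 : 0 ≤ q * (q - 1) := by nlinarith
      simp only [hk]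
      nlinarith
  have hmono : MonotoneOn h (Set.Icc 0 1) := by
    refine monotoneOn_of_deriv_nonneg (convex_Icc 0 1) hcont ?_ ?_
    · intro t ht
      rw [hint] at ht
      exact (hd1 t ht).differentiableAt.differentiableWithinAt
    · intro t ht
      rw [hint] at ht
      rw [(hd1 t ht).deriv]
      have h1 := hpow t ht
      have h2 : t ^ (q - 1) = t ^ (q - 2) * t := by
        rw [← Real.rpow_add_one ht.1.ne']
        congr 1
        ring
      rw [h2, hk]
      have h3 : t ≤ t ^ (q - 2) * t := by nlinarith [ht.1]
      have h4 : q * (q - 1) * t ≤ q * t := by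
        have : 0 ≤ q * t := mul_nonneg (by linarith) ht.1.le
        nlinarith
      nlinarith
  have hma : |a| ∈ Set.Icc (0 : ℝ) 1 := ⟨abs_nonneg _, ha⟩
  have hmb : |b| ∈ Set.Icc (0 : ℝ) 1 := ⟨abs_nonneg _, hb⟩
  have htri : |(a + b) / 2| ≤ (|a| + |b|) / 2 := by
    rw [abs_div, abs_two]
    have := abs_add_le a b
    linarith
  have h1 : h |(a + b) / 2| ≤ h ((|a| + |b|) / 2) :=
    hmono ⟨abs_nonneg _, by linarith⟩ ⟨by positivity, by linarith⟩ htri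
  have h2 := hconv.2 hma hmb (by norm_num : (0 : ℝ) ≤ 1 / 2) (by norm_num : (0 : ℝ) ≤ 1 / 2)
    (by norm_num)
  have e : (1 / 2 : ℝ) • |a| + (1 / 2 : ℝ) • |b| = (|a| + |b|) / 2 := by
    simp only [smul_eq_mul]; ring
  rw [e] at h2
  have h3 := h1.trans h2
  simp only [h, smul_eq_mul, sq_abs] at h3
  have e2 : q * (q - 1) / 8 = k / 4 := by rw [hk]; ring
  rw [e2]
  nlinarith

end ScalarPower

section LpNorm

/-- The modulus of convexity of the `ℓ_p` norm, `1 < p ≤ 2`, is at least quadratic. -/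
theorem PiLp.norm_add_le_two_sub {n : ℕ} {p : ℝ≥0∞} [Fact (1 ≤ p)] (hp1 : 1 < p) (hp2 : p ≤ 2)
    {x y : Fin n → ℝ} (hx : ‖WithLp.toLp p x‖ = 1) (hy : ‖WithLp.toLp p y‖ = 1) :
    ‖WithLp.toLp p (x + y)‖ ≤
      2 - (p.toReal - 1) / 4 * ‖(WithLp.toLp 2 (x - y) : EuclideanSpace ℝ (Fin n))‖ ^ 2 := by
  have htop : p ≠ ∞ := ne_top_of_le_ne_top (by simp) hp2
  set q := p.toReal with hq
  have hq1 : 1 < q := by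
    rw [hq, ← ENNReal.toReal_one]
    exact (ENNReal.toReal_lt_toReal (by simp) htop).2 hp1
  have hq2 : q ≤ 2 := by
    have := ENNReal.toReal_mono (by simp) hp2
    simpa using this
  have hq0 : 0 < q := by linarith
  have hnorm : ∀ z : Fin n → ℝ, ‖WithLp.toLp p z‖ ^ q = ∑ i, |z i| ^ q := by
    intro z
    rw [PiLp.norm_eq_sum hq0, ← Real.rpow_mul (Finset.sum_nonneg fun _ _ => by positivity),
      one_div_mul_cancel hq0.ne', Real.rpow_one]
    simp [hq]
  have hle : ∀ z : Fin n → ℝ, ‖WithLp.toLp p z‖ = 1 → ∀ i, |z i| ≤ 1 := by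
    intro z hz i
    have := PiLp.norm_apply_le (WithLp.toLp p z) i
    rwa [hz] at this
  have hsx := hnorm x
  have hsy := hnorm y
  rw [hx, Real.one_rpow] at hsx
  rw [hy, Real.one_rpow] at hsy
  set s := ‖(WithLp.toLp 2 (x - y) : EuclideanSpace ℝ (Fin n))‖ ^ 2 with hs
  have hs' : s = ∑ i, (x i - y i) ^ 2 := by
    rw [hs, EuclideanSpace.norm_sq_eq]
    simp
  set M := ‖WithLp.toLp p ((2⁻¹ : ℝ) • (x + y))‖ with hM
  have hMq : M ^ q ≤ 1 - q * (q - 1) / 8 * s := by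
    rw [hM, hnorm, hs', Finset.mul_sum]
    calc ∑ i, |((2⁻¹ : ℝ) • (x + y)) i| ^ q
        ≤ ∑ i, ((|x i| ^ q + |y i| ^ q) / 2 - q * (q - 1) / 8 * (x i - y i) ^ 2) := by
          refine Finset.sum_le_sum fun i _ => ?_
          have := abs_midpoint_rpow_le hq1 hq2 (hle x hx i) (hle y hy i)
          have e : ((2⁻¹ : ℝ) • (x + y)) i = (x i + y i) / 2 := by
            simp only [Pi.smul_apply, Pi.add_apply, smul_eq_mul]; ring
          rwa [e]
      _ = _ := by
          rw [Finset.sum_sub_distrib, ← Finset.sum_div, Finset.sum_add_distrib, ← hsx, ← hsy]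
          norm_num
  have hbern : 1 + q * (M - 1) ≤ M ^ q := by
    have := one_add_mul_self_le_rpow_one_add (s := M - 1) (by
      have : 0 ≤ M := norm_nonneg _
      linarith) hq1.le
    rwa [add_sub_cancel] at this
  have h2M : ‖WithLp.toLp p (x + y)‖ = 2 * M := by
    rw [hM, WithLp.toLp_smul, norm_smul, Real.norm_of_nonneg (by norm_num), ← mul_assoc,
      mul_inv_cancel₀ two_ne_zero, one_mul]
  rw [h2M]
  have h1 : q * (1 - M) ≥ q * ((q - 1) / 8 * s) := by nlinarith
  have h2 := le_of_mul_le_mul_left h1 hq0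
  linarith

variable {Z : Type*} [NormedAddCommGroup Z] [InnerProductSpace ℝ Z]

/-- Polyhedral sets can be given by inequalities over any finite index type. -/
theorem IsPolyhedralSet.of_finite {E : Type*} [AddCommGroup E] [Module ℝ E] {ι : Type*} [Finite ι]
    (l : ι → E →ₗ[ℝ] ℝ) (b : ι → ℝ) : IsPolyhedralSet {x | ∀ i, l i x ≤ b i} := by
  obtain ⟨k, ⟨e⟩⟩ := Finite.exists_equiv_fin ι
  refine ⟨k, fun i => l (e.symm i), fun i => b (e.symm i), ?_⟩
  ext x
  exact ⟨fun h i => h _, fun h i => by simpa using h (e i)⟩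

/-- A maximum of finitely many linear forms, at least one of them, is a polyhedral function. -/
theorem IsPolyhedralFun.of_le_iff {ι : Type*} [Finite ι] (l : ι → Z →ₗ[ℝ] ℝ) (N : Z → ℝ)
    (h : ∀ z t, N z ≤ t ↔ ∀ i, l i z ≤ t) : IsPolyhedralFun fun z => (N z : EReal) := by
  refine ⟨fun x => EReal.coe_ne_bot _, ⟨0, EReal.coe_ne_top _⟩, ?_⟩
  have := IsPolyhedralSet.of_finite
    (fun i => l i ∘ₗ LinearMap.fst ℝ Z ℝ - LinearMap.snd ℝ Z ℝ) (fun _ : ι => (0 : ℝ))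
  convert! this using 1
  ext q
  simp [EReal.coe_le_coe_iff, h]

theorem isPolyhedralFun_l1Norm {n : ℕ} (e : Z ≃ₗᵢ[ℝ] EuclideanSpace ℝ (Fin n)) :
    IsPolyhedralFun fun z => ((‖WithLp.toLp 1 (WithLp.ofLp (e z))‖ : ℝ) : EReal) := by
  let f : Fin n → Z →ₗ[ℝ] ℝ := fun i =>
    (EuclideanSpace.proj i : EuclideanSpace ℝ (Fin n) →L[ℝ] ℝ).toLinearMap ∘ₗ
      e.toLinearEquiv.toLinearMap
  have hf : ∀ i z, f i z = e z i := fun i z => rfl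
  -- The `ℓ_1` norm is the maximum of the forms with coefficients `± 1`.
  refine IsPolyhedralFun.of_le_iff (fun ε : Fin n → SignType => ∑ i, ((ε i : ℤ) : ℝ) • f i) _
    fun z t => ?_
  have hnorm : ‖WithLp.toLp 1 (WithLp.ofLp (e z))‖ = ∑ i, |e z i| := by
    rw [PiLp.norm_eq_sum (by simp)]
    simp
  rw [hnorm]
  simp only [LinearMap.sum_apply, LinearMap.smul_apply, hf, smul_eq_mul]
  constructor
  · refine fun h ε => le_trans (Finset.sum_le_sum fun i _ => ?_) h
    rcases ε i with _ | _ | _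
    · simp
    · simpa using neg_le_abs (e z i)
    · simpa using le_abs_self (e z i)
  · intro h
    refine le_trans (Finset.sum_le_sum fun i _ => ?_) (h fun i => SignType.sign (e z i))
    rcases lt_trichotomy (e z i) 0 with hi | hi | hi <;>
      simp [hi, abs_of_neg, abs_of_pos]

theorem isPolyhedralFun_linftyNorm {n : ℕ} (e : Z ≃ₗᵢ[ℝ] EuclideanSpace ℝ (Fin n)) :
    IsPolyhedralFun fun z => ((‖WithLp.toLp ∞ (WithLp.ofLp (e z))‖ : ℝ) : EReal) := by
  let f : Fin n → Z →ₗ[ℝ] ℝ := fun i =>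
    (EuclideanSpace.proj i : EuclideanSpace ℝ (Fin n) →L[ℝ] ℝ).toLinearMap ∘ₗ
      e.toLinearEquiv.toLinearMap
  have hf : ∀ i z, f i z = e z i := fun i z => rfl
  -- The zero form is needed for `n = 0` only.
  refine IsPolyhedralFun.of_le_iff (ι := Option (Fin n ⊕ Fin n))
    (fun i => i.elim 0 (Sum.elim f fun i => -f i)) _ fun z t => ?_
  have hnorm : ‖WithLp.toLp ∞ (WithLp.ofLp (e z))‖ = ‖WithLp.ofLp (e z)‖ := by
    rw [PiLp.norm_toLp]
  rw [hnorm]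
  constructor
  · intro h
    rintro (_ | i | i)
    · exact (norm_nonneg _).trans h
    · exact (le_abs_self _).trans ((norm_le_pi_norm (WithLp.ofLp (e z)) i).trans h)
    · exact (neg_le_abs _).trans ((norm_le_pi_norm (WithLp.ofLp (e z)) i).trans h)
  · intro h
    rw [pi_norm_le_iff_of_nonneg (h none)]
    exact fun i => abs_le'.2 ⟨h (some (Sum.inl i)), h (some (Sum.inr i))⟩

variable [FiniteDimensional ℝ Z] {Y : Type*} [NormedAddCommGroup Y] [InnerProductSpace ℝ Y]

theorem quadraticGrowthAt_lpNorm {n : ℕ} (e : Z ≃ₗᵢ[ℝ] EuclideanSpace ℝ (Fin n)) {p : ℝ≥0∞}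
    (hp1 : 1 < p) (hp2 : p ≤ 2) (E : Z →ₗ[ℝ] Y) {g z₀ : Z}
    (h₀ : g ∈ subdiffOp (fun z => ((‖WithLp.toLp p (WithLp.ofLp (e z))‖ : ℝ) : EReal)) z₀) :
    QuadraticGrowthAt (fun z => ((‖WithLp.toLp p (WithLp.ofLp (e z))‖ : ℝ) : EReal)) E g z₀ := by
  have : Fact (1 ≤ p) := ⟨hp1.le⟩
  have hq : 0 < (p.toReal - 1) / 4 := by
    have htop : p ≠ ∞ := ne_top_of_le_ne_top (by simp) hp2
    have := (ENNReal.toReal_lt_toReal (by simp) htop).2 hp1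
    rw [ENNReal.toReal_one] at this
    linarith
  refine quadraticGrowthAt_of_uniformly_convex
    (N := fun z => ‖WithLp.toLp p (WithLp.ofLp (e z))‖) ?_ ?_ ?_ ?_ hq ?_ E h₀
  · intro t x ht
    simp only [map_smul, WithLp.ofLp_smul, WithLp.toLp_smul, norm_smul, Real.norm_of_nonneg ht]
  · intro x y
    simp only [map_add, WithLp.ofLp_add, WithLp.toLp_add]
    exact norm_add_le _ _
  · intro x hx
    rw [norm_pos_iff]
    simpa using hx
  · exact continuous_norm.comp ((PiLp.continuous_toLp p _).comp
      ((PiLp.continuous_ofLp 2 _).comp e.continuous))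
  · intro z w hz hw
    have := PiLp.norm_add_le_two_sub hp1 hp2 hz hw
    have h2 : ‖(WithLp.toLp 2 ((e z).ofLp - (e w).ofLp) : EuclideanSpace ℝ (Fin n))‖ = ‖z - w‖ := by
      rw [← e.norm_map (z - w), map_sub]
      rfl
    rw [h2] at this
    rwa [map_add, WithLp.ofLp_add]

end LpNorm

/-! ### Trace norm and trace duality -/

section Contraction

variable {V : Type*} [NormedAddCommGroup V] [InnerProductSpace ℝ V]
  {W : Type*} [NormedAddCommGroup W] [InnerProductSpace ℝ W]

/-- The rank-one map `x ↦ ⟪v, x⟫ w`. -/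
noncomputable def rankOneMap (v : V) (w : W) : V →ₗ[ℝ] W :=
  (innerₛₗ ℝ v).smulRight w

@[simp]
theorem rankOneMap_apply (v : V) (w : W) (x : V) : rankOneMap v w x = inner ℝ v x • w := rfl

/-- `g` is a contraction. -/
def IsContraction (g : V →ₗ[ℝ] W) : Prop := ∀ v, ‖g v‖ ≤ ‖v‖

theorem IsContraction.inner_le {g : V →ₗ[ℝ] W} (hg : IsContraction g) (v : V) (w : W) :
    inner ℝ (g v) w ≤ ‖v‖ * ‖w‖ :=
  (real_inner_le_norm _ _).trans (mul_le_mul_of_nonneg_right (hg v) (norm_nonneg _))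

end Contraction

section TraceNorm

open Module

variable {V : Type*} [NormedAddCommGroup V] [InnerProductSpace ℝ V] [FiniteDimensional ℝ V]
  {W : Type*} [NormedAddCommGroup W] [InnerProductSpace ℝ W] [FiniteDimensional ℝ W]

/-- The trace (Hilbert-Schmidt) inner product of linear maps. -/
noncomputable def traceInner (S T : V →ₗ[ℝ] W) : ℝ :=
  LinearMap.trace ℝ V (LinearMap.adjoint S ∘ₗ T)

/-- The trace norm of a linear map: the sum of its singular values. By definition, `nuclearNorm X` is
the trace norm of `Matrix.toEuclideanLin X`. -/
noncomputable def traceNorm (T : V →ₗ[ℝ] W) : ℝ :=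
  T.singularValues.sum fun _ s => s

theorem traceInner_eq_sum {ι : Type*} [Fintype ι] (b : OrthonormalBasis ι ℝ V) (S T : V →ₗ[ℝ] W) :
    traceInner S T = ∑ i, inner ℝ (S (b i)) (T (b i)) := by
  rw [traceInner, LinearMap.trace_eq_sum_inner _ b]
  simp [LinearMap.adjoint_inner_right]

theorem traceInner_add_right (S T T' : V →ₗ[ℝ] W) :
    traceInner S (T + T') = traceInner S T + traceInner S T' := by
  simp [traceInner, LinearMap.comp_add]

theorem traceInner_smul_right (S T : V →ₗ[ℝ] W) (t : ℝ) :
    traceInner S (t • T) = t * traceInner S T := by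
  simp [traceInner, LinearMap.comp_smul]

theorem traceInner_rankOneMap_right (S : V →ₗ[ℝ] W) (v : V) (w : W) :
    traceInner S (rankOneMap v w) = inner ℝ (S v) w := by
  let b := stdOrthonormalBasis ℝ V
  rw [traceInner_eq_sum b]
  simp only [rankOneMap_apply, real_inner_smul_right]
  have : ∀ i, inner ℝ v (b i) * inner ℝ (S (b i)) w
      = inner ℝ v (b i) * inner ℝ (b i) (LinearMap.adjoint S w) := fun i => by
    rw [LinearMap.adjoint_inner_right]
  rw [Finset.sum_congr rfl fun i _ => this i, b.sum_inner_mul_inner,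
    LinearMap.adjoint_inner_right]

/-- The singular value decomposition, without normalisation of the left singular vectors: `T` maps
some orthonormal basis to an orthogonal family of vectors, the norms of which are the singular
values. -/
theorem exists_orthonormalBasis_map_orthogonal (T : V →ₗ[ℝ] W) :
    ∃ b : OrthonormalBasis (Fin (finrank ℝ V)) ℝ V,
      (∀ i j, i ≠ j → inner ℝ (T (b i)) (T (b j)) = 0) ∧ ∑ i, ‖T (b i)‖ = traceNorm T := by
  have hsym := T.isSymmetric_adjoint_comp_self
  let b := hsym.eigenvectorBasis rfl
  have hin : ∀ i j, inner ℝ (T (b i)) (T (b j)) =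
      hsym.eigenvalues rfl j * inner ℝ (b i) (b j) := by
    intro i j
    rw [← LinearMap.adjoint_inner_right, ← LinearMap.comp_apply,
      hsym.apply_eigenvectorBasis rfl j]
    simp [b, real_inner_smul_right]
  refine ⟨b, fun i j hij => ?_, ?_⟩
  · rw [hin, b.orthonormal.inner_eq_zero hij, mul_zero]
  · have hnorm : ∀ i : Fin (finrank ℝ V), ‖T (b i)‖ = T.singularValues i := by
      intro i
      rw [T.singularValues_fin rfl i, norm_eq_sqrt_real_inner, hin,
        real_inner_self_eq_norm_sq, b.norm_eq_one]
      simp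
    rw [traceNorm, Finsupp.sum_of_support_subset (s := Finset.range (finrank ℝ V)) _ _ _
      (fun _ _ => rfl), Finset.sum_range]
    · exact Finset.sum_congr rfl fun i _ => hnorm i
    · rw [LinearMap.support_singularValues, Finset.range_subset_range]
      have := T.finrank_range_add_finrank_ker
      omega

theorem IsContraction.traceInner_le {g : V →ₗ[ℝ] W} (hg : IsContraction g) (T : V →ₗ[ℝ] W) :
    traceInner g T ≤ traceNorm T := by
  obtain ⟨b, -, hb⟩ := exists_orthonormalBasis_map_orthogonal T
  rw [traceInner_eq_sum b, ← hb]
  refine Finset.sum_le_sum fun i _ => ?_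
  simpa using hg.inner_le (b i) (T (b i))

/-- The polar factor of `T`. -/
theorem exists_isContraction_traceInner_eq (T : V →ₗ[ℝ] W) :
    ∃ g, IsContraction g ∧ traceInner g T = traceNorm T := by
  obtain ⟨b, horth, hb⟩ := exists_orthonormalBasis_map_orthogonal T
  let g : V →ₗ[ℝ] W := ∑ i, rankOneMap (b i) (‖T (b i)‖⁻¹ • T (b i))
  have hg : ∀ v, g v = ∑ i, inner ℝ (b i) v • (‖T (b i)‖⁻¹ • T (b i)) := fun v => by
    simp [g, LinearMap.sum_apply]
  refine ⟨g, fun v => ?_, ?_⟩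
  · refine le_of_sq_le_sq ?_ (norm_nonneg _)
    rw [← b.sum_sq_norm_inner_right v, ← real_inner_self_eq_norm_sq, hg, sum_inner]
    refine Finset.sum_le_sum fun i _ => ?_
    rw [inner_sum, Finset.sum_eq_single i]
    · rw [inner_smul_left, inner_smul_right, real_inner_self_eq_norm_sq, norm_smul, norm_inv,
        norm_norm]
      have h1 : ‖T (b i)‖⁻¹ * ‖T (b i)‖ ≤ 1 := by
        by_cases h : ‖T (b i)‖ = 0
        · simp [h]
        · rw [inv_mul_cancel₀ h]
      have h2 : 0 ≤ ‖T (b i)‖⁻¹ * ‖T (b i)‖ := by positivity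
      have h3 : (‖T (b i)‖⁻¹ * ‖T (b i)‖) ^ 2 ≤ 1 := pow_le_one₀ h2 h1
      have h4 : 0 ≤ (inner ℝ (b i) v : ℝ) ^ 2 := sq_nonneg _
      simp only [Real.norm_eq_abs, sq_abs, conj_trivial]
      nlinarith
    · intro j _ hj
      simp [inner_smul_left, inner_smul_right, horth i j hj.symm]
    · simp
  · rw [traceInner_eq_sum b, ← hb]
    refine Finset.sum_congr rfl fun i _ => ?_
    have : g (b i) = ‖T (b i)‖⁻¹ • T (b i) := by
      rw [hg, Finset.sum_eq_single i]
      · simp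
      · intro j _ hj
        simp [b.orthonormal.inner_eq_zero hj]
      · simp
    rw [this, real_inner_smul_left, real_inner_self_eq_norm_sq]
    by_cases h : ‖T (b i)‖ = 0
    · simp [h]
    · field_simp

theorem traceNorm_add_le (S T : V →ₗ[ℝ] W) : traceNorm (S + T) ≤ traceNorm S + traceNorm T := by
  obtain ⟨g, hg, h⟩ := exists_isContraction_traceInner_eq (S + T)
  rw [← h, traceInner_add_right]
  exact add_le_add (hg.traceInner_le S) (hg.traceInner_le T)

theorem traceNorm_smul {t : ℝ} (ht : 0 ≤ t) (T : V →ₗ[ℝ] W) :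
    traceNorm (t • T) = t * traceNorm T := by
  refine le_antisymm ?_ ?_
  · obtain ⟨g, hg, h⟩ := exists_isContraction_traceInner_eq (t • T)
    rw [← h, traceInner_smul_right]
    exact mul_le_mul_of_nonneg_left (hg.traceInner_le T) ht
  · obtain ⟨g, hg, h⟩ := exists_isContraction_traceInner_eq T
    rw [← h, ← traceInner_smul_right]
    exact hg.traceInner_le _

theorem isContraction_iff {g : V →ₗ[ℝ] W} :
    IsContraction g ↔ ∀ T, traceInner g T ≤ traceNorm T := by
  refine ⟨fun hg => hg.traceInner_le, fun h v => ?_⟩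
  obtain ⟨g', hg', h'⟩ := exists_isContraction_traceInner_eq (rankOneMap v (g v))
  have h1 := h (rankOneMap v (g v))
  rw [← h', traceInner_rankOneMap_right, traceInner_rankOneMap_right,
    real_inner_self_eq_norm_sq] at h1
  have h2 := hg'.inner_le v (g v)
  rcases (norm_nonneg (g v)).eq_or_lt with h0 | h0
  · rw [← h0]; exact norm_nonneg _
  · nlinarith

/-! ### The face of the trace norm exposed by a contraction -/

/-- The spectral gap of a positive semidefinite operator above its kernel. -/
theorem LinearMap.IsSymmetric.exists_mul_norm_sub_starProjection_ker_le {Q : V →ₗ[ℝ] V}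
    (hQ : Q.IsSymmetric) (hpos : ∀ v, 0 ≤ (inner ℝ (Q v) v : ℝ)) :
    ∃ c : ℝ, 0 < c ∧
      ∀ v, c * ‖v - (LinearMap.ker Q).starProjection v‖ ^ 2 ≤ inner ℝ (Q v) v := by
  let b := hQ.eigenvectorBasis rfl
  let l := hQ.eigenvalues rfl
  have hQb : ∀ i, Q (b i) = l i • b i := fun i => hQ.apply_eigenvectorBasis rfl i
  have hl : ∀ i, 0 ≤ l i := by
    intro i
    have := hpos (b i)
    rwa [hQb, real_inner_smul_left, real_inner_self_eq_norm_sq, b.norm_eq_one, one_pow,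
      mul_one] at this
  have hsum : 0 ≤ ∑ i, (l i)⁻¹ := Finset.sum_nonneg fun i _ => inv_nonneg.2 (hl i)
  set c : ℝ := (1 + ∑ i, (l i)⁻¹)⁻¹ with hc
  have hc0 : 0 < c := by positivity
  have hcl : ∀ i, l i ≠ 0 → c ≤ l i := by
    intro i hi
    have hi' : 0 < l i := lt_of_le_of_ne (hl i) hi.symm
    rw [hc, inv_le_comm₀ (by positivity) hi']
    have := Finset.single_le_sum (f := fun i => (l i)⁻¹) (fun i _ => inv_nonneg.2 (hl i))
      (Finset.mem_univ i)
    linarith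
  refine ⟨c, hc0, fun v => ?_⟩
  set P := (LinearMap.ker Q).starProjection
  have hPv : Q (P v) = 0 := (LinearMap.ker Q).starProjection_apply_mem v
  have h1 : (inner ℝ (Q v) v : ℝ) = ∑ i, l i * inner ℝ (b i) v ^ 2 := by
    rw [← b.sum_inner_mul_inner]
    refine Finset.sum_congr rfl fun i _ => ?_
    rw [hQ, hQb, real_inner_smul_right, real_inner_comm (b i) v]
    ring
  rw [h1, ← b.sum_sq_norm_inner_right, Finset.mul_sum]
  refine Finset.sum_le_sum fun i _ => ?_
  rw [Real.norm_eq_abs, sq_abs]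
  by_cases hi : l i = 0
  · have hmem : b i ∈ LinearMap.ker Q := by rw [LinearMap.mem_ker, hQb, hi, zero_smul]
    rw [real_inner_comm, (LinearMap.ker Q).starProjection_inner_eq_zero v _ hmem, hi]
    simp
  · have h2 : (inner ℝ (b i) (P v) : ℝ) = 0 := by
      have h3 := hQ (b i) (P v)
      rw [hPv, inner_zero_right, hQb, real_inner_smul_left] at h3
      exact (mul_eq_zero.1 h3).resolve_left hi
    rw [inner_sub_right, h2, sub_zero]
    exact mul_le_mul_of_nonneg_right (hcl i hi) (sq_nonneg _)

/-- The defect `1 - g* g` of `g`. Its kernel consists of the vectors on which a contraction `g` is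
isometric. -/
noncomputable def defect (g : V →ₗ[ℝ] W) : V →ₗ[ℝ] V :=
  LinearMap.id - LinearMap.adjoint g ∘ₗ g

theorem inner_defect (g : V →ₗ[ℝ] W) (u v : V) :
    inner ℝ (defect g u) v = inner ℝ u v - inner ℝ (g u) (g v) := by
  simp [defect, inner_sub_left, LinearMap.adjoint_inner_left]

theorem defect_isSymmetric (g : V →ₗ[ℝ] W) : (defect g).IsSymmetric := fun u v => by
  rw [inner_defect, real_inner_comm (defect g v) u, inner_defect, real_inner_comm u v,
    real_inner_comm (g u) (g v)]

theorem IsContraction.inner_defect_nonneg {g : V →ₗ[ℝ] W} (hg : IsContraction g) (v : V) :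
    0 ≤ (inner ℝ (defect g v) v : ℝ) := by
  rw [inner_defect, real_inner_self_eq_norm_sq, real_inner_self_eq_norm_sq]
  have := hg v
  have := norm_nonneg (g v)
  nlinarith

theorem mem_ker_defect {g : V →ₗ[ℝ] W} {v : V} :
    v ∈ LinearMap.ker (defect g) ↔ LinearMap.adjoint g (g v) = v := by
  rw [LinearMap.mem_ker, defect, LinearMap.sub_apply, sub_eq_zero, eq_comm]
  rfl

/-- The maps `g ∘ H` with `H` symmetric and carried by the subspace on which `g` is isometric,
described without reference to `H = g* T`. -/
def isometricSymmetric (g : V →ₗ[ℝ] W) : Submodule ℝ (V →ₗ[ℝ] W) where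
  carrier := {T | (∀ u v, inner ℝ (g u) (T v) = (inner ℝ (T u) (g v) : ℝ)) ∧
    ∀ v, g (LinearMap.adjoint g (T v)) = T v}
  add_mem' := by
    rintro S T ⟨hS, hS'⟩ ⟨hT, hT'⟩
    refine ⟨fun u v => ?_, fun v => ?_⟩
    · rw [LinearMap.add_apply, LinearMap.add_apply, inner_add_right, inner_add_left, hS, hT]
    · rw [LinearMap.add_apply, map_add, map_add, hS', hT']
  zero_mem' := by simp
  smul_mem' := by
    rintro t T ⟨hT, hT'⟩
    refine ⟨fun u v => ?_, fun v => ?_⟩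
    · rw [LinearMap.smul_apply, LinearMap.smul_apply, real_inner_smul_right, real_inner_smul_left,
        hT]
    · rw [LinearMap.smul_apply, map_smul, map_smul, hT']

/-- The maps `g ∘ H` with `H` positive semidefinite and carried by the subspace on which `g` is
isometric. For a contraction `g` these are the `T` with `⟪g, T⟫` equal to the trace norm of `T`. -/
def exposedCone (g : V →ₗ[ℝ] W) : Set (V →ₗ[ℝ] W) :=
  {T | T ∈ isometricSymmetric g ∧ ∀ v, 0 ≤ (inner ℝ (g v) (T v) : ℝ)}

theorem add_mem_exposedCone {g S T : V →ₗ[ℝ] W} (hS : S ∈ exposedCone g) (hT : T ∈ exposedCone g) :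
    S + T ∈ exposedCone g := by
  refine ⟨add_mem hS.1 hT.1, fun v => ?_⟩
  rw [LinearMap.add_apply, inner_add_right]
  exact add_nonneg (hS.2 v) (hT.2 v)

theorem smul_mem_exposedCone {g T : V →ₗ[ℝ] W} (hT : T ∈ exposedCone g) {t : ℝ} (ht : 0 ≤ t) :
    t • T ∈ exposedCone g := by
  refine ⟨Submodule.smul_mem _ t hT.1, fun v => ?_⟩
  rw [LinearMap.smul_apply, real_inner_smul_right]
  exact mul_nonneg ht (hT.2 v)

theorem zero_mem_exposedCone {g : V →ₗ[ℝ] W} : 0 ∈ exposedCone g :=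
  ⟨zero_mem _, fun v => by simp⟩

/-- If `T = g H` with `H` positive semidefinite, then in an eigenbasis `b` of `H` with eigenvalues
`l` every contraction `h` has `⟪h, T⟫ = ∑ l i ⟪h (b i), g (b i)⟫ ≤ ∑ l i = ⟪g, T⟫`. -/
theorem IsContraction.traceNorm_eq_of_mem_exposedCone {g : V →ₗ[ℝ] W} (hg : IsContraction g)
    {T : V →ₗ[ℝ] W} (hT : T ∈ exposedCone g) : traceNorm T = traceInner g T := by
  refine le_antisymm ?_ (hg.traceInner_le T)
  obtain ⟨⟨hsymm, hrange⟩, hpos⟩ := hT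
  have hH : (LinearMap.adjoint g ∘ₗ T).IsSymmetric := fun u v => by
    rw [LinearMap.comp_apply, LinearMap.comp_apply, LinearMap.adjoint_inner_left,
      LinearMap.adjoint_inner_right, hsymm]
  let b := hH.eigenvectorBasis rfl
  let l := hH.eigenvalues rfl
  have hHb : ∀ i, LinearMap.adjoint g (T (b i)) = l i • b i := fun i => hH.apply_eigenvectorBasis rfl i
  have hl : ∀ i, (inner ℝ (g (b i)) (T (b i)) : ℝ) = l i := by
    intro i
    rw [← LinearMap.adjoint_inner_right, hHb, real_inner_smul_right, real_inner_self_eq_norm_sq,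
      b.norm_eq_one, one_pow, mul_one]
  obtain ⟨h, hh, hT⟩ := exists_isContraction_traceInner_eq T
  rw [← hT, traceInner_eq_sum b, traceInner_eq_sum b]
  refine Finset.sum_le_sum fun i _ => ?_
  have h1 : T (b i) = l i • g (b i) := by rw [← hrange, hHb, map_smul]
  have h2 : 0 ≤ l i := hl i ▸ hpos (b i)
  rw [hl, h1, real_inner_smul_right]
  have h3 := hh.inner_le (b i) (g (b i))
  have h4 := hg (b i)
  rw [b.norm_eq_one] at h3 h4
  nlinarith

end TraceNorm

/-! ### Quadratic growth of the trace norm -/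

section RelativeInterior

/-- A segment in `s` that ends at a point of the relative interior can be prolonged in `s`. -/
theorem exists_pos_add_smul_sub_mem_of_mem_intrinsicInterior {E : Type*} [NormedAddCommGroup E]
    [NormedSpace ℝ E] {s : Set E} {x y : E} (hx : x ∈ intrinsicInterior ℝ s) (hy : y ∈ s) :
    ∃ ε : ℝ, 0 < ε ∧ x + ε • (x - y) ∈ s := by
  obtain ⟨x', hx', rfl⟩ := mem_intrinsicInterior.1 hx
  have hmem : ∀ t : ℝ, AffineMap.lineMap (x' : E) y t ∈ affineSpan ℝ s := fun t =>
    AffineMap.lineMap_mem t x'.2 (subset_affineSpan ℝ s hy)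
  let f : ℝ → affineSpan ℝ s := fun t => ⟨AffineMap.lineMap (x' : E) y (-t), hmem _⟩
  have hf : Continuous f := by
    refine Continuous.subtype_mk ?_ _
    exact AffineMap.lineMap_continuous.comp continuous_neg
  have hf0 : f 0 = x' := by
    ext
    simp [f]
  have h0 : f ⁻¹' (interior ((↑) ⁻¹' s)) ∈ nhds (0 : ℝ) :=
    (isOpen_interior.preimage hf).mem_nhds (by rw [Set.mem_preimage, hf0]; exact hx')
  obtain ⟨ε, hε, hball⟩ := Metric.mem_nhds_iff.1 h0
  have h1 : ε / 2 ∈ Metric.ball (0 : ℝ) ε := by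
    rw [mem_ball_zero_iff, Real.norm_of_nonneg (by positivity)]
    linarith
  have h2 : ((f (ε / 2) : affineSpan ℝ s) : E) ∈ s :=
    interior_subset (s := ((↑) ⁻¹' s : Set (affineSpan ℝ s))) (hball h1)
  refine ⟨ε / 2, by positivity, ?_⟩
  have h3 : ((f (ε / 2) : affineSpan ℝ s) : E) = (x' : E) + (ε / 2) • ((x' : E) - y) := by
    simp only [f, AffineMap.lineMap_apply, vsub_eq_sub, vadd_eq_add, neg_smul, smul_sub]
    abel
  rwa [h3] at h2

/-- Values of a linear map have preimages of proportional norm. -/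
theorem LinearMap.exists_preimage_norm_le_of_finiteDimensional {E F : Type*}
    [NormedAddCommGroup E] [NormedSpace ℝ E] [NormedAddCommGroup F] [NormedSpace ℝ F]
    [FiniteDimensional ℝ E] (f : E →ₗ[ℝ] F) :
    ∃ c : ℝ, 0 < c ∧ ∀ x, ∃ x', f x' = f x ∧ ‖x'‖ ≤ c * ‖f x‖ := by
  obtain ⟨h, hh⟩ := f.rangeRestrict.exists_rightInverse_of_surjective f.range_rangeRestrict
  let h' := LinearMap.toContinuousLinearMap h
  refine ⟨1 + ‖h'‖, by positivity, fun x => ⟨h (f.rangeRestrict x), ?_, ?_⟩⟩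
  · have := LinearMap.congr_fun hh (f.rangeRestrict x)
    exact congrArg Subtype.val this
  · have h1 : ‖h (f.rangeRestrict x)‖ ≤ ‖h'‖ * ‖f x‖ := h'.le_opNorm (f.rangeRestrict x)
    have := norm_nonneg (f x)
    linarith

variable {Z : Type*} [NormedAddCommGroup Z] [InnerProductSpace ℝ Z] [FiniteDimensional ℝ Z]
  {Y : Type*} [NormedAddCommGroup Y] [InnerProductSpace ℝ Y]

/-- If `φ` grows quadratically away from a convex cone `C` of points at which `g` is a subgradient,
and the affine space `E p = E z₀` meets the interior of `C` relative to a subspace `M`, then the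
quadratic growth condition holds. A point `q` of `C` is corrected in two moves to satisfy
`E p = E z₀`: subtract some `m ∈ M` of norm proportional to `‖E q - E z₀‖`, and return to `C` by
moving towards the point `x` in the relative interior, by a fraction proportional to `‖m‖`. -/
theorem quadraticGrowthAt_of_relative_interior {φ : Z → EReal} {E : Z →ₗ[ℝ] Y} {g z₀ : Z}
    {C : Set Z} {M : Submodule ℝ Z} (hCM : ∀ z ∈ C, z ∈ M) (hC0 : 0 ∈ C)
    (hadd : ∀ a ∈ C, ∀ b ∈ C, a + b ∈ C) (hsmul : ∀ a ∈ C, ∀ t : ℝ, 0 ≤ t → t • a ∈ C)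
    (hsub : ∀ p ∈ C, g ∈ subdiffOp φ p) (hz₀ : z₀ ∈ C) {x : Z} (hEx : E x = E z₀)
    {r : ℝ} (hr : 0 < r) (hint : ∀ m ∈ M, ‖m‖ ≤ r → x + m ∈ C) {K : ℝ} (hK : 0 < K)
    (hgrow : ∀ᶠ z in nhds z₀, ∀ G : ℝ, 0 ≤ G →
      φ z = φ z₀ + ((inner ℝ g (z - z₀) + G : ℝ) : EReal) → ∃ q ∈ C, ‖z - q‖ ^ 2 ≤ K * G) :
    QuadraticGrowthAt φ E g z₀ := by
  obtain ⟨c, hc, hinv⟩ := (E ∘ₗ M.subtype).exists_preimage_norm_le_of_finiteDimensional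
  let E' := LinearMap.toContinuousLinearMap E
  have hE' : ∀ x, ‖E x‖ ≤ ‖E'‖ * ‖x‖ := fun x => E'.le_opNorm x
  set d : ℝ := 2 + ‖z₀ - x‖ with hd
  have hd0 : 0 < d := by positivity
  set b : ℝ := (d + r) / r * c with hb
  have hb0 : 0 < b := by positivity
  set a : ℝ := 1 + b * ‖E'‖ with ha
  have ha1 : 1 ≤ a := by
    have : 0 ≤ b * ‖E'‖ := by positivity
    linarith
  refine ⟨2 * a ^ 2 * K + 2 * b ^ 2, by positivity, ?_⟩
  filter_upwards [hgrow, Metric.ball_mem_nhds z₀ one_pos] with z hz hz1 G hG hφ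
  obtain ⟨q, hq, hzq⟩ := hz G hG hφ
  have hz1 : ‖z - z₀‖ < 1 := by simpa [dist_eq_norm] using hz1
  set e := ‖E z - E z₀‖ with he
  set ρ := ‖z - q‖ with hρ
  have he0 : 0 ≤ e := norm_nonneg _
  have hρ0 : 0 ≤ ρ := norm_nonneg _
  suffices h : ∃ p, E p = E z₀ ∧ g ∈ subdiffOp φ p ∧ ‖z - p‖ ≤ a * ρ + b * e by
    obtain ⟨p, h1, h2, h3⟩ := h
    refine ⟨p, h1, h2, ?_⟩
    calc ‖z - p‖ ^ 2 ≤ (a * ρ + b * e) ^ 2 := by gcongr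
      _ ≤ 2 * a ^ 2 * ρ ^ 2 + 2 * b ^ 2 * e ^ 2 := by nlinarith [sq_nonneg (a * ρ - b * e)]
      _ ≤ 2 * a ^ 2 * (K * G) + 2 * b ^ 2 * e ^ 2 := by gcongr
      _ ≤ _ := by
        have e1 : 0 ≤ 2 * a ^ 2 * K * e ^ 2 := by positivity
        have e2 : 0 ≤ 2 * b ^ 2 * G := by positivity
        nlinarith
  rcases le_total 1 ρ with hρ1 | hρ1
  · refine ⟨z₀, rfl, hsub _ hz₀, hz1.le.trans ?_⟩
    have : 0 ≤ b * e := by positivity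
    nlinarith
  obtain ⟨⟨m, hm⟩, hEm, hmn⟩ := hinv ⟨q - z₀, sub_mem (hCM q hq) (hCM z₀ hz₀)⟩
  simp only [LinearMap.comp_apply, Submodule.subtype_apply, Submodule.coe_norm] at hEm hmn
  have hEq : ‖E (q - z₀)‖ ≤ e + ‖E'‖ * ρ := by
    have : E (q - z₀) = (E z - E z₀) - E (z - q) := by
      rw [map_sub, map_sub]; abel
    rw [this]
    exact (norm_sub_le _ _).trans (add_le_add_right (hE' _) _)
  have hm1 : ‖m‖ ≤ c * (e + ‖E'‖ * ρ) := hmn.trans (mul_le_mul_of_nonneg_left hEq hc.le)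
  have hcorr : ‖m‖ • x - r • m ∈ C := by
    by_cases h0 : m = 0
    · simpa [h0] using hC0
    have hm0 : ‖m‖ ≠ 0 := norm_ne_zero_iff.2 h0
    have h1 := hint (-((r / ‖m‖) • m)) (neg_mem (M.smul_mem _ hm)) (by
      rw [norm_neg, norm_smul, Real.norm_of_nonneg (by positivity), div_mul_cancel₀ _ hm0])
    have h2 := hsmul _ h1 ‖m‖ (norm_nonneg m)
    have h3 : ‖m‖ • (x + -((r / ‖m‖) • m)) = ‖m‖ • x - r • m := by
      rw [smul_add, smul_neg, smul_smul, mul_div_cancel₀ _ hm0, sub_eq_add_neg]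
    rwa [h3] at h2
  have hs : 0 < r + ‖m‖ := by positivity
  set p := (r + ‖m‖)⁻¹ • (r • q + (‖m‖ • x - r • m)) with hp
  refine ⟨p, ?_, hsub _ (hsmul _ (hadd _ (hsmul q hq r hr.le) _ hcorr) _ (inv_nonneg.2 hs.le)), ?_⟩
  · have h1 : E m = E q - E z₀ := by rw [hEm, map_sub]
    have h2 : r • E q + (‖m‖ • E z₀ - r • (E q - E z₀)) = (r + ‖m‖) • E z₀ := by module
    rw [hp, map_smul, map_add, map_sub, map_smul, map_smul, map_smul, hEx, h1, h2, smul_smul,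
      inv_mul_cancel₀ hs.ne', one_smul]
  · have h1 : q - p = (r + ‖m‖)⁻¹ • (‖m‖ • (q - x) + r • m) := by
      have h2 : q = (r + ‖m‖)⁻¹ • ((r + ‖m‖) • q) := by
        rw [smul_smul, inv_mul_cancel₀ hs.ne', one_smul]
      rw [hp]
      nth_rewrite 1 [h2]
      rw [← smul_sub]
      congr 1
      module
    have hqx : ‖q - x‖ ≤ d := by
      have h2 : q - x = -(z - q) + (z - z₀) + (z₀ - x) := by abel
      rw [h2]
      refine (norm_add₃_le).trans ?_
      rw [norm_neg]
      linarith
    have h2 : ‖q - p‖ ≤ (d + r) / r * ‖m‖ := by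
      rw [h1, norm_smul, norm_inv, Real.norm_of_nonneg hs.le]
      have h3 : ‖‖m‖ • (q - x) + r • m‖ ≤ ‖m‖ * (d + r) := by
        refine (norm_add_le _ _).trans ?_
        rw [norm_smul, norm_smul, norm_norm, Real.norm_of_nonneg hr.le]
        have := mul_le_mul_of_nonneg_left hqx (norm_nonneg m)
        linarith
      calc (r + ‖m‖)⁻¹ * ‖‖m‖ • (q - x) + r • m‖ ≤ r⁻¹ * (‖m‖ * (d + r)) := by
            gcongr
            have := norm_nonneg m
            linarith
        _ = _ := by field_simp
    have h3 : (d + r) / r * ‖m‖ ≤ b * (e + ‖E'‖ * ρ) := by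
      rw [hb, mul_assoc]
      exact mul_le_mul_of_nonneg_left hm1 (by positivity)
    have h4 : ‖z - p‖ ≤ ρ + ‖q - p‖ := by
      have : z - p = (z - q) + (q - p) := by abel
      rw [this]
      exact norm_add_le _ _
    rw [ha]
    linarith

end RelativeInterior

section TraceNormGrowth

open Module

variable {V : Type*} [NormedAddCommGroup V] [InnerProductSpace ℝ V] [FiniteDimensional ℝ V]
  {W : Type*} [NormedAddCommGroup W] [InnerProductSpace ℝ W] [FiniteDimensional ℝ W]
  {Z : Type*} [NormedAddCommGroup Z] [InnerProductSpace ℝ Z]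
  {L : Z ≃ₗ[ℝ] (V →ₗ[ℝ] W)}

theorem norm_symm_rankOneMap (hL : ∀ x y, inner ℝ x y = traceInner (L x) (L y)) (v : V) (w : W) :
    ‖L.symm (rankOneMap v w)‖ = ‖v‖ * ‖w‖ := by
  rw [← sq_eq_sq₀ (norm_nonneg _) (by positivity), ← real_inner_self_eq_norm_sq, hL,
    L.apply_symm_apply, traceInner_rankOneMap_right, rankOneMap_apply, real_inner_smul_left,
    real_inner_self_eq_norm_sq, real_inner_self_eq_norm_sq, mul_pow]

/-- The operator norm is at most the norm of the trace inner product. -/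
theorem norm_apply_le_of_traceInner (hL : ∀ x y, inner ℝ x y = traceInner (L x) (L y)) (z : Z)
    (v : V) : ‖L z v‖ ≤ ‖z‖ * ‖v‖ := by
  have h1 : (inner ℝ z (L.symm (rankOneMap v (L z v))) : ℝ) = ‖L z v‖ ^ 2 := by
    rw [hL, L.apply_symm_apply, traceInner_rankOneMap_right, real_inner_self_eq_norm_sq]
  have h2 := real_inner_le_norm z (L.symm (rankOneMap v (L z v)))
  rw [h1, norm_symm_rankOneMap hL] at h2
  rcases (norm_nonneg (L z v)).eq_or_lt with h0 | h0
  · rw [← h0]; positivity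
  · nlinarith

theorem traceNorm_le_finrank_mul_norm (hL : ∀ x y, inner ℝ x y = traceInner (L x) (L y)) (z : Z) :
    traceNorm (L z) ≤ finrank ℝ V * ‖z‖ := by
  obtain ⟨b, -, hb⟩ := exists_orthonormalBasis_map_orthogonal (L z)
  rw [← hb]
  calc ∑ i, ‖L z (b i)‖ ≤ ∑ _i : Fin (finrank ℝ V), ‖z‖ :=
        Finset.sum_le_sum fun i _ => by simpa using norm_apply_le_of_traceInner hL z (b i)
    _ = _ := by simp

theorem mem_subdiffOp_traceNorm_iff (hL : ∀ x y, inner ℝ x y = traceInner (L x) (L y)) {g x : Z} :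
    g ∈ subdiffOp (fun z => (traceNorm (L z) : EReal)) x ↔
      IsContraction (L g) ∧ traceNorm (L x) = inner ℝ g x := by
  rw [mem_subdiffOp_iff_of_sublinear, isContraction_iff]
  · refine and_congr_left fun _ => ⟨fun h T => ?_, fun h y => ?_⟩
    · have := h (L.symm T)
      rwa [hL, L.apply_symm_apply] at this
    · rw [hL]
      exact h _
  · intro t x ht
    rw [map_smul, traceNorm_smul ht]
  · intro x y
    rw [map_add]
    exact traceNorm_add_le _ _

theorem rankOneMap_mem_exposedCone {g : V →ₗ[ℝ] W} {u : V} (hu : u ∈ LinearMap.ker (defect g)) :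
    rankOneMap u (g u) ∈ exposedCone g := by
  have hu' := mem_ker_defect.1 hu
  have h1 : ∀ v, (inner ℝ (g v) (g u) : ℝ) = inner ℝ v u := fun v => by
    rw [← LinearMap.adjoint_inner_right, hu']
  refine ⟨⟨fun x y => ?_, fun x => ?_⟩, fun x => ?_⟩
  · rw [rankOneMap_apply, rankOneMap_apply, real_inner_smul_right, real_inner_smul_left, h1,
      real_inner_comm (g y) (g u), h1, real_inner_comm u x, real_inner_comm y u]
    ring
  · rw [rankOneMap_apply, map_smul, map_smul, hu']
  · rw [rankOneMap_apply, real_inner_smul_right, h1, real_inner_comm]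
    exact mul_self_nonneg _

/-- The trace norm grows quadratically away from the exposed cone of a contraction `g`. With
`T = L z` and the basis `b` of its singular value decomposition, `T = ∑ ⟪b i, ·⟫ T (b i)` is compared
term by term with `∑ σ i ⟪P (b i), ·⟫ g (P (b i))`, where `σ i = ‖T (b i)‖` and `P` projects onto
the subspace on which `g` is isometric. The gap is the sum of the `δ i = σ i - ⟪g (b i), T (b i)⟫`,
and `σ i * δ i` bounds the squares of both `‖T (b i) - σ i • g (b i)‖` and
`σ i * ‖b i - P (b i)‖`. -/
theorem exists_exposedCone_norm_sub_sq_le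
    (hL : ∀ x y, inner ℝ x y = traceInner (L x) (L y)) {g : Z} (hg : IsContraction (L g)) :
    ∃ K : ℝ, 0 < K ∧ ∀ z, ∃ q, L q ∈ exposedCone (L g) ∧
      ‖z - q‖ ^ 2 ≤ K * traceNorm (L z) * (traceNorm (L z) - inner ℝ g z) := by
  obtain ⟨c, hc, hgap⟩ := (defect_isSymmetric (L g)).exists_mul_norm_sub_starProjection_ker_le
    hg.inner_defect_nonneg
  set P := (LinearMap.ker (defect (L g))).starProjection with hP
  have hPmem : ∀ v, P v ∈ LinearMap.ker (defect (L g)) := fun v =>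
    (LinearMap.ker (defect (L g))).starProjection_apply_mem v
  have hPle : ∀ v, ‖P v‖ ≤ ‖v‖ := fun v => by
    have h1 := P.le_opNorm v
    have h2 := (LinearMap.ker (defect (L g))).starProjection_norm_le
    have h3 := norm_nonneg v
    nlinarith
  set a : ℝ := 1 + 2 * (√c)⁻¹ with ha
  have ha0 : 0 < a := by positivity
  refine ⟨2 * a ^ 2, by positivity, fun z => ?_⟩
  obtain ⟨b, -, hb⟩ := exists_orthonormalBasis_map_orthogonal (L z)
  set T := L z with hT
  let σ := fun i => ‖T (b i)‖
  let δ := fun i => σ i - inner ℝ (L g (b i)) (T (b i))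
  have hσ : ∀ i, 0 ≤ σ i := fun i => norm_nonneg _
  have hgb : ∀ i, ‖L g (b i)‖ ≤ 1 := fun i => by simpa using hg (b i)
  have hδ' : ∀ i, σ i * (1 - ‖L g (b i)‖) ≤ δ i := by
    intro i
    have := real_inner_le_norm (L g (b i)) (T (b i))
    simp only [δ, σ]
    linarith
  have hδ : ∀ i, 0 ≤ δ i := fun i =>
    (mul_nonneg (hσ i) (by linarith [hgb i])).trans (hδ' i)
  have hsumδ : ∑ i, δ i = traceNorm T - inner ℝ g z := by
    rw [hL, traceInner_eq_sum b, ← hb, ← Finset.sum_sub_distrib]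
  let q : Z := ∑ i, σ i • L.symm (rankOneMap (P (b i)) (L g (P (b i))))
  refine ⟨q, ?_, ?_⟩
  · have : L q = ∑ i, σ i • rankOneMap (P (b i)) (L g (P (b i))) := by
      simp [q, map_sum, map_smul]
    rw [this]
    refine Finset.sum_induction _ (· ∈ exposedCone (L g)) (fun _ _ => add_mem_exposedCone)
      zero_mem_exposedCone fun i _ =>
        smul_mem_exposedCone (rankOneMap_mem_exposedCone (hPmem _)) (hσ i)
  have hz : z = ∑ i, L.symm (rankOneMap (b i) (T (b i))) := by
    apply L.injective
    rw [map_sum, ← hT]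
    ext v
    simp only [L.apply_symm_apply, LinearMap.sum_apply, rankOneMap_apply]
    nth_rewrite 1 [← b.sum_repr' v]
    rw [map_sum]
    simp only [map_smul]
  have hterm : ∀ i, ‖L.symm (rankOneMap (b i) (T (b i))) -
      σ i • L.symm (rankOneMap (P (b i)) (L g (P (b i))))‖ ≤ a * √2 * (√(σ i) * √(δ i)) := by
    intro i
    have h1 : ‖T (b i) - σ i • L g (b i)‖ ^ 2 ≤ 2 * (σ i * δ i) := by
      rw [norm_sub_sq_real, real_inner_smul_right, norm_smul, Real.norm_of_nonneg (hσ i),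
        real_inner_comm]
      have h2 : (σ i * ‖L g (b i)‖) ^ 2 ≤ σ i ^ 2 := by
        refine pow_le_pow_left₀ (mul_nonneg (hσ i) (norm_nonneg _)) ?_ 2
        have := mul_le_mul_of_nonneg_left (hgb i) (hσ i)
        linarith
      have h3 : ‖T (b i)‖ = σ i := rfl
      rw [h3]
      simp only [δ]
      nlinarith
    have h2 : (σ i * ‖b i - P (b i)‖) ^ 2 ≤ 2 * (σ i * δ i) / c := by
      have h3 := hgap (b i)
      rw [inner_defect, real_inner_self_eq_norm_sq, real_inner_self_eq_norm_sq,
        b.norm_eq_one] at h3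
      rw [le_div_iff₀ hc]
      have h4 : σ i ^ 2 * (c * ‖b i - P (b i)‖ ^ 2) ≤ σ i ^ 2 * (1 ^ 2 - ‖L g (b i)‖ ^ 2) :=
        mul_le_mul_of_nonneg_left h3 (sq_nonneg _)
      have h5 := mul_le_mul_of_nonneg_left (hδ' i) (hσ i)
      have h6 : 0 ≤ σ i * (σ i * (1 - ‖L g (b i)‖)) * (1 - ‖L g (b i)‖) :=
        mul_nonneg (mul_nonneg (hσ i) (mul_nonneg (hσ i) (by linarith [hgb i])))
          (by linarith [hgb i])
      nlinarith
    set s := √(2 * (σ i * δ i)) with hs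
    have h3 : ‖T (b i) - σ i • L g (b i)‖ ≤ s := Real.le_sqrt_of_sq_le h1
    have h4 : σ i * ‖b i - P (b i)‖ ≤ s * (√c)⁻¹ := by
      rw [← div_eq_mul_inv, hs, ← Real.sqrt_div' _ hc.le]
      exact Real.le_sqrt_of_sq_le h2
    have hs' : s = √2 * (√(σ i) * √(δ i)) := by
      rw [hs, Real.sqrt_mul (by norm_num), Real.sqrt_mul (hσ i)]
    have hdec : L.symm (rankOneMap (b i) (T (b i))) -
        σ i • L.symm (rankOneMap (P (b i)) (L g (P (b i)))) =
        L.symm (rankOneMap (b i) (T (b i) - σ i • L g (b i))) +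
        σ i • L.symm (rankOneMap (b i) (L g (b i - P (b i)))) +
        σ i • L.symm (rankOneMap (b i - P (b i)) (L g (P (b i)))) := by
      rw [← map_smul L.symm, ← map_smul L.symm, ← map_smul L.symm, ← map_sub L.symm,
        ← map_add L.symm, ← map_add L.symm]
      congr 1
      ext v
      simp only [LinearMap.sub_apply, LinearMap.add_apply, LinearMap.smul_apply, rankOneMap_apply,
        map_sub, inner_sub_left]
      module
    rw [hdec, mul_assoc, ← hs']
    refine norm_add₃_le.trans ?_
    rw [norm_smul, norm_smul, Real.norm_of_nonneg (hσ i), norm_symm_rankOneMap hL,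
      norm_symm_rankOneMap hL, norm_symm_rankOneMap hL, b.norm_eq_one, one_mul, one_mul]
    have h5 : ‖L g (P (b i))‖ ≤ 1 := (hg _).trans ((hPle _).trans (b.norm_eq_one i).le)
    have h6 : σ i * ‖L g (b i - P (b i))‖ ≤ s * (√c)⁻¹ :=
      (mul_le_mul_of_nonneg_left (hg _) (hσ i)).trans h4
    have h7 : σ i * (‖b i - P (b i)‖ * ‖L g (P (b i))‖) ≤ s * (√c)⁻¹ := by
      refine le_trans (mul_le_mul_of_nonneg_left ?_ (hσ i)) h4
      exact mul_le_of_le_one_right (norm_nonneg _) h5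
    rw [ha]
    linarith
  have hnorm : ‖z - q‖ ≤ a * √2 * (√(traceNorm T) * √(traceNorm T - inner ℝ g z)) := by
    rw [← hsumδ, ← hb]
    nth_rewrite 1 [hz]
    rw [← Finset.sum_sub_distrib]
    refine (norm_sum_le _ _).trans ((Finset.sum_le_sum fun i _ => hterm i).trans ?_)
    rw [← Finset.mul_sum]
    exact mul_le_mul_of_nonneg_left (Real.sum_sqrt_mul_sqrt_le _ hσ hδ) (by positivity)
  have hN : 0 ≤ traceNorm T := hb ▸ Finset.sum_nonneg fun i _ => hσ i
  have hG : 0 ≤ traceNorm T - inner ℝ g z := hsumδ ▸ Finset.sum_nonneg fun i _ => hδ i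
  calc ‖z - q‖ ^ 2 ≤ (a * √2 * (√(traceNorm T) * √(traceNorm T - inner ℝ g z))) ^ 2 := by gcongr
    _ = _ := by
      rw [mul_pow, mul_pow, mul_pow, Real.sq_sqrt hN, Real.sq_sqrt hG, Real.sq_sqrt (by norm_num)]
      ring

/-- Where `g` is a subgradient of the trace norm, the point lies in the exposed cone. -/
theorem mem_exposedCone_of_mem_subdiffOp (hL : ∀ x y, inner ℝ x y = traceInner (L x) (L y))
    {g x : Z} (h : g ∈ subdiffOp (fun z => (traceNorm (L z) : EReal)) x) :
    L x ∈ exposedCone (L g) := by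
  obtain ⟨hg, hx⟩ := (mem_subdiffOp_traceNorm_iff hL).1 h
  obtain ⟨K, -, hK⟩ := exists_exposedCone_norm_sub_sq_le hL hg
  obtain ⟨q, hq, hle⟩ := hK x
  rw [hx, sub_self, mul_zero] at hle
  have : x = q := sub_eq_zero.1 (norm_eq_zero.1 ((pow_eq_zero_iff two_ne_zero).1
    (le_antisymm hle (sq_nonneg _))))
  rwa [this]

/-- If `g` is in the relative interior of the subdifferential at `x`, then `L x` is injective on the
subspace on which `L g` is isometric. Otherwise take `w ≠ 0` in this subspace with `L x w = 0`:
annihilating `w` in `L g` gives another subgradient at `x`, and prolonging the segment beyond `g`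
gives one that expands `w`. -/
theorem eq_zero_of_mem_intrinsicInterior_subdiffOp
    (hL : ∀ x y, inner ℝ x y = traceInner (L x) (L y)) {g x : Z}
    (h : g ∈ intrinsicInterior ℝ (subdiffOp (fun z => (traceNorm (L z) : EReal)) x)) {w : V}
    (hw : w ∈ LinearMap.ker (defect (L g))) (hxw : L x w = 0) : w = 0 := by
  by_contra hne
  have hw0 : 0 < ‖w‖ := norm_pos_iff.2 hne
  have hgw : ‖L g w‖ ^ 2 = ‖w‖ ^ 2 := by
    rw [← real_inner_self_eq_norm_sq, ← LinearMap.adjoint_inner_right, mem_ker_defect.1 hw,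
      real_inner_self_eq_norm_sq]
  obtain ⟨hg, hx⟩ := (mem_subdiffOp_traceNorm_iff hL).1 (intrinsicInterior_subset h)
  set s : ℝ := (‖w‖ ^ 2)⁻¹ with hs
  have hsw : s * ‖w‖ ^ 2 = 1 := inv_mul_cancel₀ (by positivity)
  have hmem : g - s • L.symm (rankOneMap w (L g w)) ∈
      subdiffOp (fun z => (traceNorm (L z) : EReal)) x := by
    refine (mem_subdiffOp_traceNorm_iff hL).2 ⟨fun v => ?_, ?_⟩
    · have h1 : L (g - s • L.symm (rankOneMap w (L g w))) v
          = L g (v - (s * inner ℝ w v) • w) := by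
        rw [map_sub, map_smul, L.apply_symm_apply, LinearMap.sub_apply, LinearMap.smul_apply,
          rankOneMap_apply, map_sub, map_smul, smul_smul]
      rw [h1]
      refine (hg _).trans (le_of_sq_le_sq ?_ (norm_nonneg v))
      rw [norm_sub_sq_real, real_inner_smul_right, norm_smul, mul_pow, Real.norm_eq_abs, sq_abs,
        real_inner_comm w v]
      have h2 : (s * inner ℝ w v) ^ 2 * ‖w‖ ^ 2 = s * (inner ℝ w v) ^ 2 := by
        calc (s * inner ℝ w v) ^ 2 * ‖w‖ ^ 2 = (s * ‖w‖ ^ 2) * (s * (inner ℝ w v) ^ 2) := by ring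
          _ = _ := by rw [hsw, one_mul]
      have h3 : 0 ≤ s * (inner ℝ w v : ℝ) ^ 2 := by positivity
      rw [h2]
      nlinarith
    · have h1 : (inner ℝ (L.symm (rankOneMap w (L g w))) x : ℝ) = 0 := by
        rw [real_inner_comm, hL, L.apply_symm_apply, traceInner_rankOneMap_right, hxw,
          inner_zero_left]
      rw [hx, inner_sub_left, real_inner_smul_left, h1, mul_zero, sub_zero]
  obtain ⟨ε, hε, hprol⟩ := exists_pos_add_smul_sub_mem_of_mem_intrinsicInterior h hmem
  have hcontr := ((mem_subdiffOp_traceNorm_iff hL).1 hprol).1 w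
  have h1 : L (g + ε • (g - (g - s • L.symm (rankOneMap w (L g w))))) w = (1 + ε) • L g w := by
    rw [sub_sub_cancel, map_add, map_smul, map_smul, L.apply_symm_apply, LinearMap.add_apply,
      LinearMap.smul_apply, LinearMap.smul_apply, rankOneMap_apply, real_inner_self_eq_norm_sq,
      smul_smul s, hsw, one_smul, add_smul, one_smul]
  have h2 : ‖L g w‖ = ‖w‖ := (sq_eq_sq₀ (norm_nonneg _) (norm_nonneg _)).1 hgw
  rw [h1, norm_smul, Real.norm_of_nonneg (by positivity), h2] at hcontr
  nlinarith

/-- The exposed cone is a neighbourhood of `L x` relative to `isometricSymmetric (L g)`, if `L x` is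
injective on the subspace on which `L g` is isometric. -/
theorem exists_pos_add_mem_exposedCone (hL : ∀ x y, inner ℝ x y = traceInner (L x) (L y)) {g x : Z}
    (hg : IsContraction (L g)) (hx : L x ∈ exposedCone (L g))
    (hker : ∀ w ∈ LinearMap.ker (defect (L g)), L x w = 0 → w = 0) :
    ∃ r : ℝ, 0 < r ∧ ∀ m, L m ∈ isometricSymmetric (L g) → ‖m‖ ≤ r →
      L (x + m) ∈ exposedCone (L g) := by
  -- `Q = g* x + (1 - g* g)` is positive definite.
  set H : V →ₗ[ℝ] V := LinearMap.adjoint (L g) ∘ₗ L x with hH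
  have hHin : ∀ u v, (inner ℝ (H u) v : ℝ) = inner ℝ (L x u) (L g v) := fun u v => by
    rw [hH, LinearMap.comp_apply, LinearMap.adjoint_inner_left]
  have hHsymm : H.IsSymmetric := fun u v => by
    rw [hHin, real_inner_comm (H v) u, hHin, real_inner_comm, hx.1.1, real_inner_comm]
  have hHpos : ∀ v, 0 ≤ (inner ℝ (H v) v : ℝ) := fun v => by
    rw [hHin, real_inner_comm]
    exact hx.2 v
  set Q : V →ₗ[ℝ] V := H + defect (L g) with hQ
  have hQin : ∀ v, (inner ℝ (Q v) v : ℝ) = inner ℝ (H v) v + inner ℝ (defect (L g) v) v :=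
    fun v => by rw [hQ, LinearMap.add_apply, inner_add_left]
  have hzero : ∀ {R : V →ₗ[ℝ] V}, R.IsSymmetric → (∀ v, 0 ≤ (inner ℝ (R v) v : ℝ)) → ∀ v,
      (inner ℝ (R v) v : ℝ) = 0 → R v = 0 := by
    intro R hR hRpos v hv
    obtain ⟨c, hc, h⟩ := hR.exists_mul_norm_sub_starProjection_ker_le hRpos
    have h1 := h v
    rw [hv] at h1
    have h2 : ‖v - (LinearMap.ker R).starProjection v‖ ^ 2 ≤ 0 := by
      by_contra! h3
      have := mul_pos hc h3
      linarith
    have h3 := sub_eq_zero.1 (norm_eq_zero.1 ((pow_eq_zero_iff two_ne_zero).1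
      (le_antisymm h2 (sq_nonneg _))))
    rw [h3]
    exact (LinearMap.ker R).starProjection_apply_mem v
  have hQker : LinearMap.ker Q = ⊥ := by
    rw [LinearMap.ker_eq_bot']
    intro v hv
    have h1 := hQin v
    rw [hv, inner_zero_left] at h1
    have h2 := hHpos v
    have h3 := hg.inner_defect_nonneg v
    have h4 : H v = 0 := hzero hHsymm hHpos v (by linarith)
    have h5 : defect (L g) v = 0 :=
      hzero (defect_isSymmetric _) hg.inner_defect_nonneg v (by linarith)
    refine hker v h5 ?_
    rw [← hx.1.2 v]
    have h6 : LinearMap.adjoint (L g) (L x v) = 0 := h4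
    rw [h6, map_zero]
  obtain ⟨r, hr, hQr⟩ := (hHsymm.add (defect_isSymmetric (L g))
    ).exists_mul_norm_sub_starProjection_ker_le fun v => by
      have h1 := hQin v
      have h2 := hHpos v
      have h3 := hg.inner_defect_nonneg v
      exact h1 ▸ add_nonneg h2 h3
  have hQr' : ∀ v, r * ‖v‖ ^ 2 ≤ inner ℝ (Q v) v := by
    intro v
    have h1 := hQr v
    have h2 : (LinearMap.ker (H + defect (L g))).starProjection v = 0 := by
      have h3 : (LinearMap.ker Q).starProjection v ∈ LinearMap.ker Q :=
        (LinearMap.ker Q).starProjection_apply_mem v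
      rw [hQker] at h3
      exact (Submodule.mem_bot ℝ).1 (hQker ▸ h3)
    rwa [h2, sub_zero] at h1
  refine ⟨r, hr, fun m hm hmr => ?_⟩
  have hsum : L (x + m) ∈ isometricSymmetric (L g) := by
    rw [map_add]
    exact add_mem hx.1 hm
  refine ⟨hsum, fun v => ?_⟩
  -- `g* (x + m)` is carried by the range of `P`, where the quadratic form of `1 - g* g` vanishes.
  set P := (LinearMap.ker (defect (L g))).starProjection
  have hPv : P v ∈ LinearMap.ker (defect (L g)) :=
    (LinearMap.ker (defect (L g))).starProjection_apply_mem v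
  have hred : ∀ y, L y ∈ isometricSymmetric (L g) →
      (inner ℝ (L g v) (L y v) : ℝ) = inner ℝ (L g (P v)) (L y (P v)) := by
    intro y hy
    have h1 : ∀ u, LinearMap.adjoint (L g) (L y u) ∈ LinearMap.ker (defect (L g)) := fun u => by
      rw [mem_ker_defect, hy.2]
    have h2 : ∀ u, (inner ℝ (L g v) (L y u) : ℝ) = inner ℝ (L g (P v)) (L y u) := by
      intro u
      rw [← LinearMap.adjoint_inner_right, ← LinearMap.adjoint_inner_right, ← sub_eq_zero,
        ← inner_sub_left]
      exact (LinearMap.ker (defect (L g))).starProjection_inner_eq_zero v _ (h1 u)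
    rw [h2, hy.1, real_inner_comm, h2, real_inner_comm, ← hy.1]
  rw [hred (x + m) hsum, map_add, LinearMap.add_apply, inner_add_right]
  have h1 := hQr' (P v)
  rw [hQin, LinearMap.mem_ker.1 hPv, inner_zero_left, add_zero, hHin, real_inner_comm] at h1
  have h2 : -(inner ℝ (L g (P v)) (L m (P v)) : ℝ) ≤ r * ‖P v‖ ^ 2 := by
    refine (neg_le_abs _).trans ((abs_real_inner_le_norm _ _).trans ?_)
    calc ‖L g (P v)‖ * ‖L m (P v)‖ ≤ ‖P v‖ * (‖m‖ * ‖P v‖) := by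
          gcongr
          · exact hg _
          · exact norm_apply_le_of_traceInner hL m _
      _ = ‖m‖ * ‖P v‖ ^ 2 := by ring
      _ ≤ _ := by gcongr
  linarith

variable [FiniteDimensional ℝ Z] {Y : Type*} [NormedAddCommGroup Y] [InnerProductSpace ℝ Y]

theorem quadraticGrowthAt_traceNorm (hL : ∀ x y, inner ℝ x y = traceInner (L x) (L y))
    {E : Z →ₗ[ℝ] Y} {g z₀ x : Z}
    (h₀ : g ∈ subdiffOp (fun z => (traceNorm (L z) : EReal)) z₀) (hEx : E x = E z₀)
    (hx : g ∈ intrinsicInterior ℝ (subdiffOp (fun z => (traceNorm (L z) : EReal)) x)) :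
    QuadraticGrowthAt (fun z => (traceNorm (L z) : EReal)) E g z₀ := by
  obtain ⟨hg, hgz₀⟩ := (mem_subdiffOp_traceNorm_iff hL).1 h₀
  have hxC := mem_exposedCone_of_mem_subdiffOp hL (intrinsicInterior_subset hx)
  obtain ⟨r, hr, hint⟩ := exists_pos_add_mem_exposedCone hL hg hxC fun w hw hxw =>
    eq_zero_of_mem_intrinsicInterior_subdiffOp hL hx hw hxw
  obtain ⟨K, hK, hgrow⟩ := exists_exposedCone_norm_sub_sq_le hL hg
  set R : ℝ := finrank ℝ V * (‖z₀‖ + 1) + 1 with hR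
  refine quadraticGrowthAt_of_relative_interior (C := {z | L z ∈ exposedCone (L g)})
    (M := (isometricSymmetric (L g)).comap L.toLinearMap) (x := x) (r := r) (K := K * R)
    (fun z hz => hz.1) ?_ ?_ ?_ ?_ (mem_exposedCone_of_mem_subdiffOp hL h₀) hEx hr hint
    (by positivity) ?_
  · change L 0 ∈ exposedCone (L g)
    rw [map_zero]
    exact zero_mem_exposedCone
  · intro a ha b hb
    change L (a + b) ∈ exposedCone (L g)
    rw [map_add]
    exact add_mem_exposedCone ha hb
  · intro a ha t ht
    change L (t • a) ∈ exposedCone (L g)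
    rw [map_smul]
    exact smul_mem_exposedCone ha ht
  · intro p hp
    exact (mem_subdiffOp_traceNorm_iff hL).2 ⟨hg, by rw [hL, hg.traceNorm_eq_of_mem_exposedCone hp]⟩
  · filter_upwards [Metric.ball_mem_nhds z₀ one_pos] with z hz G hG hφ
    obtain ⟨q, hq, hle⟩ := hgrow z
    refine ⟨q, hq, hle.trans ?_⟩
    rw [← EReal.coe_add, EReal.coe_eq_coe_iff, inner_sub_right, hgz₀] at hφ
    have h1 : traceNorm (L z) - inner ℝ g z = G := by linarith
    rw [h1]
    have h2 : traceNorm (L z) ≤ R := by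
      refine (traceNorm_le_finrank_mul_norm hL z).trans ?_
      have h3 : ‖z‖ ≤ ‖z₀‖ + 1 := by
        have h4 : ‖z - z₀‖ < 1 := by simpa [dist_eq_norm] using hz
        have h5 := norm_le_norm_add_norm_sub' z z₀
        linarith
      have h4 := mul_le_mul_of_nonneg_left h3 (Nat.cast_nonneg (α := ℝ) (finrank ℝ V))
      linarith
    gcongr

end TraceNormGrowth

/-! ### The four cases -/

section Conditions

variable {Z : Type*} [NormedAddCommGroup Z] [InnerProductSpace ℝ Z] [FiniteDimensional ℝ Z]
  {Y : Type*} [NormedAddCommGroup Y] [InnerProductSpace ℝ Y] [FiniteDimensional ℝ Y]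

theorem traceInner_toEuclideanLin {m n : ℕ} (X X' : Matrix (Fin m) (Fin n) ℝ) :
    traceInner (Matrix.toEuclideanLin X) (Matrix.toEuclideanLin X') =
      Matrix.trace (Matrix.transpose X * X') := by
  rw [traceInner_eq_sum (EuclideanSpace.basisFun (Fin n) ℝ), Matrix.trace]
  refine Finset.sum_congr rfl fun j _ => ?_
  simp [Matrix.mul_apply, PiLp.inner_apply, Matrix.toLpLin_apply, mul_comm]

theorem CondC2.metricallySubregularAt {A : Z → Set Z} {B : Z → Z} (h : CondC2 A B) {z₀ : Z}
    (h₀ : 0 ∈ opAdd A B z₀) : MetricallySubregularAt (opAdd A B) z₀ 0 := by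
  obtain ⟨⟨g, hg⟩, hA⟩ := h
  obtain rfl : B = g := funext hg
  exact (hA.opAdd_affine g).metricallySubregularAt h₀

/-- For `A = ∂φ` and a composite gradient `B`, quadratic growth at the given zero suffices. -/
theorem IsCompositeGradient.metricallySubregularAt {φ : Z → EReal} (hbot : ∀ x, φ x ≠ ⊥)
    (htop : ∃ x, φ x ≠ ⊤) {B : Z → Z} (hB : IsCompositeGradient Y B) {z₀ : Z}
    (h₀ : 0 ∈ opAdd (subdiffOp φ) B z₀)
    (hg : ∀ (E : Z →ₗ[ℝ] Y) (μ : ℝ), 0 < μ →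
      (∀ x y, μ * ‖E x - E y‖ ^ 2 ≤ inner ℝ (B x - B y) (x - y)) → (∀ x y, E x = E y → B x = B y) →
      -B z₀ ∈ subdiffOp φ z₀ → QuadraticGrowthAt φ E (-B z₀) z₀) :
    MetricallySubregularAt (opAdd (subdiffOp φ) B) z₀ 0 := by
  obtain ⟨E, μ, hμ, hBE, hmono⟩ := hB.exists_strongly_monotone
  obtain ⟨a, ha, h⟩ := h₀
  have h₀' : -B z₀ ∈ subdiffOp φ z₀ := by rwa [← eq_neg_of_add_eq_zero_left h.symm]
  exact (hg E μ hμ hmono hBE h₀').metricallySubregularAt hbot htop hμ hBE hmono h₀'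

theorem CondC3.metricallySubregularAt {A : Z → Set Z} {B : Z → Z} (h : CondC3 Y A B) {z₀ : Z}
    (h₀ : 0 ∈ opAdd A B z₀) : MetricallySubregularAt (opAdd A B) z₀ 0 := by
  obtain ⟨hB, h⟩ := h
  have hpoly : ∀ φ : Z → EReal, IsPolyhedralFun φ → 0 ∈ opAdd (subdiffOp φ) B z₀ →
      MetricallySubregularAt (opAdd (subdiffOp φ) B) z₀ 0 := fun φ hφ h₀ =>
    hB.metricallySubregularAt hφ.1 hφ.2.1 h₀ fun E _ _ _ _ hg => hφ.quadraticGrowthAt E hg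
  rcases h with ⟨n, e, p, hp, rfl⟩ | ⟨φ, hφ, rfl⟩
  · rcases hp with ⟨hp1, hp2⟩ | rfl
    · rcases hp1.eq_or_lt with rfl | hp1
      · exact hpoly _ (isPolyhedralFun_l1Norm e) h₀
      · exact hB.metricallySubregularAt (fun _ => EReal.coe_ne_bot _) ⟨0, EReal.coe_ne_top _⟩ h₀
          fun E _ _ _ _ hg => quadraticGrowthAt_lpNorm e hp1 hp2 E hg
    · exact hpoly _ (isPolyhedralFun_linftyNorm e) h₀
  · exact hpoly φ hφ h₀

theorem CondC4.metricallySubregularAt {A : Z → Set Z} {B : Z → Z} (h : CondC4 Y A B) {z₀ : Z}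
    (h₀ : 0 ∈ opAdd A B z₀) : MetricallySubregularAt (opAdd A B) z₀ 0 := by
  obtain ⟨hB, m, n, e, he, rfl, x, hx⟩ := h
  let L : Z ≃ₗ[ℝ] (EuclideanSpace ℝ (Fin n) →ₗ[ℝ] EuclideanSpace ℝ (Fin m)) :=
    e.trans Matrix.toEuclideanLin
  have hL : ∀ x y : Z, inner ℝ x y = traceInner (L x) (L y) := fun x y => by
    rw [he]
    exact (traceInner_toEuclideanLin _ _).symm
  refine hB.metricallySubregularAt (fun _ => EReal.coe_ne_bot _) ⟨0, EReal.coe_ne_top _⟩ h₀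
    fun E μ hμ hmono hBE hg => ?_
  -- Monotonicity of the subdifferential, at the zeros `x` and `z₀`, identifies their images by `E`.
  have hx' := intrinsicInterior_subset hx
  have hmon : (inner ℝ (B x - B z₀) (x - z₀) : ℝ) ≤ 0 := by
    have h1 := hg x
    have h2 := hx' z₀
    rw [← EReal.coe_add, EReal.coe_le_coe_iff] at h1 h2
    rw [inner_neg_left] at h1 h2
    rw [← neg_sub x z₀, inner_neg_right] at h2
    rw [inner_sub_left]
    linarith
  have hEx : E x = E z₀ := by
    have h1 := (hmono x z₀).trans hmon
    have h2 : ‖E x - E z₀‖ ^ 2 ≤ 0 := by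
      by_contra! h3
      have := mul_pos hμ h3
      linarith
    exact sub_eq_zero.1 (norm_eq_zero.1 ((pow_eq_zero_iff two_ne_zero).1
      (le_antisymm h2 (sq_nonneg _))))
  rw [hBE x z₀ hEx] at hx
  exact quadraticGrowthAt_traceNorm hL hg hEx hx

end Conditions

theorem mainTheorem8
    {Z : Type*} [NormedAddCommGroup Z] [InnerProductSpace ℝ Z] [FiniteDimensional ℝ Z]
    {Y : Type*} [NormedAddCommGroup Y] [InnerProductSpace ℝ Y] [FiniteDimensional ℝ Y]
    (A : Z → Set Z) (hA : IsMaximalMonotoneOp A)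
    (B : Z → Z) (hB : ∃ K : ℝ≥0, LipschitzWith K B)
    (zstar : Z) (hz : (0 : Z) ∈ opAdd A B zstar)
    (h : CondC1 A B ∨ CondC2 A B ∨ CondC3 Y A B ∨ CondC4 Y A B) :
    MetricallySubregularAt (opAdd A B) zstar 0 := by
  rcases h with h | h | h | h
  · exact IsStronglyMonotoneOp.metricallySubregularAt h hz
  · exact h.metricallySubregularAt hz
  · exact h.metricallySubregularAt hz
  · exact h.metricallySubregularAt hz
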